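/- Let $B_m$ denote the Bernoulli numbers, defined by $\frac{x}{e^x-1}=\sum_{m\ge0}\frac{B_m}{m!}x^m$ (so $B_1=-\tfrac12$); let $S_k^{(1)}(l)$ denote the (signed) Stirling numbers of the first kind, defined by $x(x+1)\cdots(x+k-1)=(-1)^k\sum_{l=0}^k(-1)^lS_k^{(1)}(l)\,x^l$; let $m!!$ denote the double factorial, extended to negative odd integers by $(m+2)!!=(m+2)\,m!!$ (so $(-1)!!=1$, $(-3)!!=-1$); and let $\zeta$ be the Riemann zeta function. For $k\ge1$ put $$a_k=(-1)^k\sum_{l=1}^k(-1)^l\frac{(2l-3)!!}{2^l(l+1)!}B_{l+1}S_k^{(1)}(l),\qquad b_k=(-1)^k\sum_{l=1}^k(-1)^l\frac{(2l-1)!!}{2^{l+1}(l+2)!}B_{l+2}S_k^{(1)}(l),$$ $$c_k=(-1)^k\sum_{l=1}^k(-1)^l\frac{(2l-5)!!}{2^{l-1}\,l!}B_{l}S_k^{(1)}(l).$$ Then for every integer $n\ge1$ the following three series converge (absolutely) and $$\sum_{k=0}^n\sqrt k=\frac23n^{3/2}+\frac12\sqrt n-\frac1{4\pi}\zeta\!\left(\tfrac32\right)+\sqrt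 n\sum_{k=1}^\infty\frac{a_k}{(n+1)(n+2)\cdots(n+k)},$$ $$\sum_{k=0}^n\sqrt k=\frac23n^{3/2}+\frac12\sqrt n-\frac1{4\pi}\zeta\!\left(\tfrac32\right)+\frac1{24\sqrt n}+\sum_{k=1}^\infty\frac{b_k}{\sqrt n\,(n+1)(n+2)\cdots(n+k)},$$ $$\sum_{k=0}^n\sqrt k=\frac23n^{3/2}-\frac1{4\pi}\zeta\!\left(\tfrac32\right)+n\sqrt n\sum_{k=1}^\infty\frac{c_k}{(n+1)(n+2)\cdots(n+k)}.$$ The first coefficients are $a_1=a_2=\frac1{24}$, $a_3=\frac{53}{640}$, $a_4=\frac{79}{320}$; $b_1=0$, $b_2=-\frac1{1920}$, $b_3=-\frac1{640}$, $b_4=-\frac{259}{46080}$, $b_5=-\frac{115}{4608}$; and $c_1=\frac12$, $c_2=\frac{13}{24}$, $c_3=\frac98$, $c_4=\frac{2213}{640}$. -/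

import Mathlib

namespace SqrtSum

/-- Double factorial `m!!` of an integer, extended to the negative odd integers by the recursion
`(m + 2)!! = (m + 2) * m!!`, so that `(-1)!! = 1` and `(-(2j+1))!! = (-1)^j / (2j-1)!!`.
On negative even integers it is not defined mathematically (here: `0`). -/
def dfac : ℤ → ℚ
  | Int.ofNat m => (Nat.doubleFactorial m : ℚ)
  | Int.negSucc m =>
      if Even m then (-1) ^ (m / 2) / (Nat.doubleFactorial (m - 1) : ℚ) else 0

/-- Signed Stirling numbers of the first kind `S_k^{(1)}(l)`. -/
def stirlingS (k l : ℕ) : ℤ := (-1) ^ (k + l) * (Nat.stirlingFirst k l : ℤ)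

/-- The defining recursion of the double factorial on all odd integers. -/
theorem dfac_add_two (m : ℤ) (hm : Odd m) : dfac (m + 2) = ((m + 2 : ℤ) : ℚ) * dfac m := by
  obtain ⟨j, rfl⟩ := hm
  rcases j with j | j
  · have h1 : (2 * Int.ofNat j + 1 + 2 : ℤ) = Int.ofNat (2 * j + 1 + 2) := by simp
    have h2 : (2 * Int.ofNat j + 1 : ℤ) = Int.ofNat (2 * j + 1) := by simp
    rw [h1, h2]
    simp only [dfac, Nat.doubleFactorial_add_two]
    simp only [Int.ofNat_eq_natCast]
    push_cast
    ring
  · rcases j with _ | i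
    · norm_num [dfac, Int.negSucc_eq]
      change dfac (Int.ofNat 1) = dfac (Int.negSucc 0)
      simp [dfac]
    · have h1 : (2 * Int.negSucc (i + 1) + 1 + 2 : ℤ) = Int.negSucc (2 * i) := by
        simp only [Int.negSucc_eq]; push_cast; ring
      have h2 : (2 * Int.negSucc (i + 1) + 1 : ℤ) = Int.negSucc (2 * i + 2) := by
        simp only [Int.negSucc_eq]; push_cast; ring
      rw [h1, h2]
      have e1 : Even (2 * i) := even_two_mul i
      have e2 : Even (2 * i + 2) := by simp [parity_simps]
      simp only [dfac, e1, e2, if_true]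
      have d1 : 2 * i / 2 = i := by omega
      have d2 : (2 * i + 2) / 2 = i + 1 := by omega
      have d3 : 2 * i + 2 - 1 = 2 * i + 1 := by omega
      rw [d1, d2, d3, Nat.doubleFactorial_add_one]
      have hpos : (Nat.doubleFactorial (2 * i - 1) : ℚ) ≠ 0 := by
        exact_mod_cast (Nat.doubleFactorial_pos _).ne'
      have hne : (2 * (i : ℚ) + 1) ≠ 0 := by positivity
      simp only [Int.negSucc_eq]
      push_cast
      field_simp
      ring

/-- The signed Stirling numbers are the connecting coefficients in
`x (x+1) ⋯ (x+k-1) = (-1)^k ∑_{l=0}^{k} (-1)^l S_k^{(1)}(l) x^l`. -/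
theorem ascPochhammer_eval_eq_sum_stirlingS (k : ℕ) (x : ℝ) :
    (ascPochhammer ℝ k).eval x =
      (-1) ^ k * ∑ l ∈ Finset.range (k + 1), (-1) ^ l * (stirlingS k l : ℝ) * x ^ l := by
  have key : ∀ k : ℕ, (ascPochhammer ℝ k).eval x =
      ∑ l ∈ Finset.range (k + 1), (Nat.stirlingFirst k l : ℝ) * x ^ l := by
    intro k
    induction k with
    | zero => simp
    | succ k ih =>
      rw [ascPochhammer_succ_eval, ih, Finset.sum_range_succ' _ (k + 1)]
      simp only [Nat.stirlingFirst_succ_succ, Nat.stirlingFirst_succ_zero]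
      push_cast
      simp only [add_mul, Finset.sum_add_distrib]
      have hA : ∑ l ∈ Finset.range (k + 1),
          (k : ℝ) * (Nat.stirlingFirst k (l + 1) : ℝ) * x ^ (l + 1) =
          k * ∑ l ∈ Finset.range (k + 1), (Nat.stirlingFirst k l : ℝ) * x ^ l := by
        have h := Finset.sum_range_succ'
          (fun l => (k : ℝ) * ((Nat.stirlingFirst k l : ℝ) * x ^ l)) (k + 1)
        rw [Finset.sum_range_succ, Nat.stirlingFirst_eq_zero_of_lt (Nat.lt_succ_self k)] at h
        rw [Finset.mul_sum]
        have h0 : (k : ℝ) * ((Nat.stirlingFirst k 0 : ℝ) * x ^ 0) = 0 := by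
          cases k <;> simp
        rw [h0] at h
        simp only [Nat.cast_zero, zero_mul, mul_zero, add_zero] at h
        rw [h]
        exact Finset.sum_congr rfl fun l _ => by ring
      have hB : ∑ l ∈ Finset.range (k + 1), (Nat.stirlingFirst k l : ℝ) * x ^ (l + 1) =
          (∑ l ∈ Finset.range (k + 1), (Nat.stirlingFirst k l : ℝ) * x ^ l) * x := by
        rw [Finset.sum_mul]
        exact Finset.sum_congr rfl fun l _ => by ring
      rw [hA, hB]
      ring
  rw [key, Finset.mul_sum]
  refine Finset.sum_congr rfl fun l _ => ?_
  have h : ((-1 : ℝ) ^ k * (-1) ^ k) = 1 := by rw [← mul_pow]; simp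
  have h' : ((-1 : ℝ) ^ l * (-1) ^ l) = 1 := by rw [← mul_pow]; simp
  simp only [stirlingS]
  push_cast
  rw [pow_add]
  linear_combination (-(Nat.stirlingFirst k l : ℝ) * x ^ l) * h * ((-1 : ℝ) ^ l * (-1) ^ l) -
    ((Nat.stirlingFirst k l : ℝ) * x ^ l) * h'

/-- `(-1)^k ∑_{l=1}^k (-1)^l (2l-3)!! / (2^l (l+1)!) B_{l+1} S_k^{(1)}(l)`. -/
def coeffA (k : ℕ) : ℚ :=
  (-1) ^ k * ∑ l ∈ Finset.Icc 1 k,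
    (-1) ^ l * (dfac (2 * (l : ℤ) - 3) / (2 ^ l * (Nat.factorial (l + 1) : ℚ))) *
      bernoulli (l + 1) * (stirlingS k l : ℚ)

/-- `(-1)^k ∑_{l=1}^k (-1)^l (2l-1)!! / (2^(l+1) (l+2)!) B_{l+2} S_k^{(1)}(l)`. -/
def coeffB (k : ℕ) : ℚ :=
  (-1) ^ k * ∑ l ∈ Finset.Icc 1 k,
    (-1) ^ l * (dfac (2 * (l : ℤ) - 1) / (2 ^ (l + 1) * (Nat.factorial (l + 2) : ℚ))) *
      bernoulli (l + 2) * (stirlingS k l : ℚ)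

/-- `(-1)^k ∑_{l=1}^k (-1)^l (2l-5)!! / (2^(l-1) l!) B_l S_k^{(1)}(l)`. -/
def coeffC (k : ℕ) : ℚ :=
  (-1) ^ k * ∑ l ∈ Finset.Icc 1 k,
    (-1) ^ l * (dfac (2 * (l : ℤ) - 5) / (2 ^ (l - 1) * (Nat.factorial l : ℚ))) *
      bernoulli l * (stirlingS k l : ℚ)

/-- `(n+1)(n+2)⋯(n+k)`. -/
def risingProd (n k : ℕ) : ℝ := ∏ j ∈ Finset.Icc 1 k, ((n : ℝ) + (j : ℝ))

/-- The real number `ζ(3/2)`. -/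
noncomputable def zetaThreeHalves : ℝ := (riemannZeta (3 / 2 : ℂ)).re

end SqrtSum

open Filter Topology MeasureTheory Set

namespace SqrtSum

/-! The remainder of the summation formula has the closed form R(n) = π^(-1/2) ∫_0^∞ s^(-1/2)
e^(-ns) P(s) ds, where P(s) = ∑_{m≥1} 1/(s² + (2πm)²). By the cotangent series, (1 - e^(-s)) P(s) =
(1/2) ∫_0^1 (1/2 - t) e^(-ts) dt, so R(n) - R(n+1) is the error of the trapezoidal rule for √x on
[n, n+1] (`remainderIntegral_sub_succ`). Integrating termwise at n = 0 gives R(0) = ζ(3/2)/(4π), so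
induction from n = 0 proves the summation formula with remainder R(n), and no limit n → ∞ is needed.

For n ≥ 1 the substitution s = 2πm u/n turns R(n)/√n into a weighted sum of Laplace transforms, at
the frequencies 2πm, of the kernel n/(n² + u²) = Re 1/(n - iu). This kernel has the inverse
factorial expansion 1/(n - iu) = ∑_k (1+iu)⋯(k+iu) / ((n+1)⋯(n+k+1)). The products expand in powers
of iu with Stirling coefficients, and the moments of the powers are Bernoulli numbers by Euler's
formula for ζ(2q) (`hasSum_moment`). Integrating termwise therefore yields the numbers a_k.
Convergence rests on |(1+iu)⋯(k+iu)| ≤ k! e^(2u), from Euler's sine product: since 2π ≥ 6,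
exponential growth of rate 3 is absorbed uniformly in m, and the remainder after K terms is O(1/K).

The other two series follow from the first. The Stirling recurrence gives a_{k+1} = k a_k + b_k and
c_{k+1} = k c_k + a_k, and such a relation makes the two inverse factorial series differ by a
telescoping sum (`tsum_div_risingProd_eq`). -/

/-! ### Stirling sums and the three coefficient families -/

/-- `∑_{l=1}^{k+1} c(k+1,l) β_{l-1}` with the unsigned Stirling numbers `c` of the first kind. -/
def stirlingSum {R : Type*} [CommSemiring R] (β : ℕ → R) (k : ℕ) : R :=
  ∑ p ∈ Finset.range (k + 1), (Nat.stirlingFirst (k + 1) (p + 1) : R) * β p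

/-- The recurrence of the Stirling numbers: one of its two terms rescales the sum, the other shifts
`β`. Since the three coefficient families come from successive shifts of one sequence, this links
each to the next. -/
theorem stirlingSum_succ {R : Type*} [CommSemiring R] (β : ℕ → R) (k : ℕ) :
    stirlingSum β (k + 1) =
      (k + 1) * stirlingSum β k + stirlingSum (fun p => β (p + 1)) k := by
  unfold stirlingSum
  have h1 : ∑ p ∈ Finset.range (k + 1 + 1),
      (Nat.stirlingFirst (k + 1) (p + 1) : R) * β p =
      ∑ p ∈ Finset.range (k + 1), (Nat.stirlingFirst (k + 1) (p + 1) : R) * β p := by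
    rw [Finset.sum_range_succ, Nat.stirlingFirst_eq_zero_of_lt (Nat.lt_succ_self (k + 1))]
    simp
  have h2 : ∑ p ∈ Finset.range (k + 1 + 1), (Nat.stirlingFirst (k + 1) p : R) * β p =
      ∑ p ∈ Finset.range (k + 1), (Nat.stirlingFirst (k + 1) (p + 1) : R) * β (p + 1) := by
    rw [Finset.sum_range_succ']
    simp
  rw [← h1, ← h2, Finset.mul_sum, ← Finset.sum_add_distrib]
  refine Finset.sum_congr rfl fun p _ => ?_
  rw [Nat.stirlingFirst_succ_succ]
  push_cast
  ring

theorem signed_sum_eq_stirlingSum (β : ℕ → ℚ) (B : ℕ → ℚ) (k : ℕ) :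
    (((-1) ^ (k + 1) * ∑ l ∈ Finset.Icc 1 (k + 1),
      (-1) ^ l * β l * B l * (stirlingS (k + 1) l : ℚ) : ℚ) : ℝ) =
      stirlingSum (fun p => ((β (p + 1) * B (p + 1) : ℚ) : ℝ)) k := by
  have h : Finset.Icc 1 (k + 1) = (Finset.range (k + 1)).map ⟨(· + 1), add_left_injective 1⟩ := by
    ext x
    simp only [Finset.mem_Icc, Finset.mem_map, Finset.mem_range, Function.Embedding.coeFn_mk]
    exact ⟨fun hx => ⟨x - 1, by omega, by omega⟩, by rintro ⟨y, hy, rfl⟩; omega⟩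
  rw [h, Finset.sum_map, stirlingSum]
  push_cast
  rw [Finset.mul_sum]
  refine Finset.sum_congr rfl fun p _ => ?_
  have e : ((-1 : ℝ) ^ (k + 1) * (-1) ^ (p + 1)) * ((-1) ^ (k + 1) * (-1) ^ (p + 1)) = 1 := by
    rw [← pow_add, ← mul_pow]; simp
  simp only [stirlingS, Function.Embedding.coeFn_mk]
  push_cast
  rw [pow_add (-1 : ℝ) (k + 1) (p + 1)]
  linear_combination (β (p + 1) * B (p + 1) * (Nat.stirlingFirst (k + 1) (p + 1)) : ℝ) * e

/-- The coefficient `(2p-1)!! B_{p+2} / (2^(p+1) (p+2)!)` of `n^(-p-1)` in the asymptotic expansion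
of the remainder divided by `√n`. -/
def alpha (p : ℕ) : ℝ :=
  ((dfac (2 * (p : ℤ) - 1) / (2 ^ (p + 1) * (Nat.factorial (p + 2) : ℚ)) *
    bernoulli (p + 2) : ℚ) : ℝ)

theorem coeffA_succ (k : ℕ) : (coeffA (k + 1) : ℝ) = stirlingSum alpha k := by
  rw [coeffA, signed_sum_eq_stirlingSum
    (fun l => dfac (2 * (l : ℤ) - 3) / (2 ^ l * (Nat.factorial (l + 1) : ℚ)))
    (fun l => bernoulli (l + 1))]
  congr 1
  funext p
  rw [alpha, show 2 * ((p + 1 : ℕ) : ℤ) - 3 = 2 * (p : ℤ) - 1 by push_cast; ring]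

theorem coeffB_succ (k : ℕ) :
    (coeffB (k + 1) : ℝ) = stirlingSum (fun p => alpha (p + 1)) k := by
  rw [coeffB, signed_sum_eq_stirlingSum
    (fun l => dfac (2 * (l : ℤ) - 1) / (2 ^ (l + 1) * (Nat.factorial (l + 2) : ℚ)))
    (fun l => bernoulli (l + 2))]
  rfl

theorem dfac_neg_one : dfac (-1) = 1 := by
  change dfac (Int.negSucc 0) = 1
  simp [dfac]

theorem dfac_neg_three : dfac (-3) = -1 := by
  change dfac (Int.negSucc 2) = -1
  simp [dfac]

/-- The sequence is `alpha` preceded by 1/2, which is (-3)!! B_1; shifting it gives back `alpha`. -/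
theorem coeffC_succ (k : ℕ) :
    (coeffC (k + 1) : ℝ) = stirlingSum (fun p => Nat.casesOn p (1 / 2) alpha) k := by
  rw [coeffC, signed_sum_eq_stirlingSum
    (fun l => dfac (2 * (l : ℤ) - 5) / (2 ^ (l - 1) * (Nat.factorial l : ℚ)))
    (fun l => bernoulli l)]
  congr 1
  funext p
  cases p with
  | zero => norm_num [dfac_neg_three, bernoulli_one]
  | succ p =>
    simp only [alpha]
    rw [show 2 * ((p + 1 + 1 : ℕ) : ℤ) - 5 = 2 * (p : ℤ) - 1 by push_cast; ring]
    rfl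

theorem coeffA_add_two (k : ℕ) :
    (coeffA (k + 2) : ℝ) = (k + 1) * coeffA (k + 1) + coeffB (k + 1) := by
  rw [coeffA_succ, coeffA_succ, coeffB_succ, stirlingSum_succ]

theorem coeffC_add_two (k : ℕ) :
    (coeffC (k + 2) : ℝ) = (k + 1) * coeffC (k + 1) + coeffA (k + 1) := by
  rw [coeffC_succ, coeffC_succ, coeffA_succ, stirlingSum_succ]

theorem bernoulli_four : bernoulli 4 = -1 / 30 := by
  rw [bernoulli_eq_bernoulli'_of_ne_one (by decide), bernoulli'_four]

theorem bernoulli_six : bernoulli 6 = 1 / 42 := by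
  have h := sum_bernoulli 7
  have h3 : bernoulli 3 = 0 := bernoulli_eq_zero_of_odd (by decide) (by decide)
  have h5 : bernoulli 5 = 0 := bernoulli_eq_zero_of_odd (by decide) (by decide)
  simp only [Finset.sum_range_succ, Finset.sum_range_zero, bernoulli_zero, bernoulli_one,
    bernoulli_two, h3, bernoulli_four, h5] at h
  norm_num [Nat.choose] at h
  linarith

theorem coeff_values :
    (coeffA 1 = 1 / 24 ∧ coeffA 2 = 1 / 24 ∧ coeffA 3 = 53 / 640 ∧ coeffA 4 = 79 / 320) ∧
    (coeffB 1 = 0 ∧ coeffB 2 = -1 / 1920 ∧ coeffB 3 = -1 / 640 ∧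
      coeffB 4 = -259 / 46080 ∧ coeffB 5 = -115 / 4608) ∧
    (coeffC 1 = 1 / 2 ∧ coeffC 2 = 13 / 24 ∧ coeffC 3 = 9 / 8 ∧ coeffC 4 = 2213 / 640) := by
  have h3 : bernoulli 3 = 0 := bernoulli_eq_zero_of_odd (by decide) (by decide)
  have h5 : bernoulli 5 = 0 := bernoulli_eq_zero_of_odd (by decide) (by decide)
  have h7 : bernoulli 7 = 0 := bernoulli_eq_zero_of_odd (by decide) (by decide)
  have d : ∀ m : ℕ, dfac m = (Nat.doubleFactorial m : ℚ) := fun m => rfl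
  have d1 : dfac 1 = 1 := by simpa using d 1
  have d3 : dfac 3 = 3 := by simpa [Nat.doubleFactorial] using d 3
  have d5 : dfac 5 = 15 := by simpa [Nat.doubleFactorial] using d 5
  have d7 : dfac 7 = 105 := by simpa [Nat.doubleFactorial] using d 7
  have d9 : dfac 9 = 945 := by simpa [Nat.doubleFactorial] using d 9
  refine ⟨⟨?_, ?_, ?_, ?_⟩, ⟨?_, ?_, ?_, ?_, ?_⟩, ?_, ?_, ?_, ?_⟩ <;>
  simp only [coeffA, coeffB, coeffC, Finset.sum_Icc_succ_top, Nat.reduceAdd, Nat.reduceLeDiff,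
    Finset.Icc_self, Finset.sum_singleton, stirlingS, Nat.stirlingFirst] <;>
  norm_num [Finset.sum_Icc_succ_top, dfac_neg_one, dfac_neg_three, bernoulli_one, bernoulli_two,
    h3, bernoulli_four, h5, bernoulli_six, h7, d1, d3, d5, d7, d9, Nat.factorial,
    Nat.stirlingFirst]

/-! ### Convergence and telescoping of inverse factorial series -/

theorem risingProd_succ (n k : ℕ) : risingProd n (k + 1) = risingProd n k * (n + k + 1) := by
  rw [risingProd, Finset.prod_Icc_succ_top (by omega), risingProd]
  push_cast
  ring

theorem risingProd_zero (n : ℕ) : risingProd n 0 = 1 := by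
  simp [risingProd]

theorem risingProd_pos (n k : ℕ) : 0 < risingProd n k := by
  refine Finset.prod_pos fun j hj => ?_
  have : 0 < j := (Finset.mem_Icc.mp hj).1
  positivity

theorem factorial_succ_le_risingProd {n : ℕ} (hn : 1 ≤ n) (k : ℕ) :
    ((k + 1).factorial : ℝ) ≤ risingProd n k := by
  induction k with
  | zero => simp [risingProd_zero]
  | succ k ih =>
    rw [risingProd_succ, Nat.factorial_succ, mul_comm]
    have : (1 : ℝ) ≤ n := by exact_mod_cast hn
    push_cast
    exact mul_le_mul ih (by linarith) (by positivity) (risingProd_pos n k).le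

theorem factorial_div_risingProd_le {n : ℕ} (hn : 1 ≤ n) (k : ℕ) :
    (k.factorial : ℝ) / risingProd n k ≤ 1 / (k + 1) := by
  have h := factorial_succ_le_risingProd hn k
  rw [Nat.factorial_succ] at h
  push_cast at h
  rw [div_le_div_iff₀ (risingProd_pos n k) (by positivity)]
  linarith

theorem factorial_div_risingProd_succ_le {n : ℕ} (hn : 1 ≤ n) (k : ℕ) :
    (k.factorial : ℝ) / risingProd n (k + 1) ≤ 1 / (k + 1) ^ 2 := by
  have h := factorial_succ_le_risingProd hn (k + 1)
  rw [Nat.factorial_succ, Nat.factorial_succ] at h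
  push_cast at h
  rw [div_le_div_iff₀ (risingProd_pos n _) (by positivity)]
  have : (0 : ℝ) ≤ k.factorial * (k + 1) := by positivity
  nlinarith

theorem summable_one_div_succ_sq_mul_sqrt :
    Summable fun k : ℕ => 1 / ((k : ℝ) + 1) ^ 2 * √((k : ℝ) + 1) := by
  have h := (summable_nat_add_iff 1).mpr (Real.summable_one_div_nat_rpow.mpr
    (show (1 : ℝ) < 3 / 2 by norm_num))
  refine h.congr fun k => ?_
  have hk : (0 : ℝ) < k + 1 := by positivity
  push_cast
  rw [Real.sqrt_eq_rpow, ← Real.rpow_natCast, one_div, one_div, ← Real.rpow_neg hk.le,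
    ← Real.rpow_neg hk.le, ← Real.rpow_add hk]
  norm_num

theorem tendsto_sqrt_succ_div : Tendsto (fun k : ℕ => √((k : ℝ) + 1) / (k + 1)) atTop (𝓝 0) := by
  have h : Tendsto (fun k : ℕ => (√((k : ℝ) + 1))⁻¹) atTop (𝓝 0) :=
    tendsto_inv_atTop_zero.comp (Real.tendsto_sqrt_atTop.comp
      (tendsto_atTop_add_const_right _ _ tendsto_natCast_atTop_atTop))
  refine h.congr fun k => ?_
  have hk : (0 : ℝ) < k + 1 := by positivity
  rw [Real.sqrt_div_self', one_div]

/-- An inverse factorial series whose coefficients satisfy `|c_{k+1}| ≤ M k! √(k+1)` converges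
absolutely for `n ≥ 1`, and its terms are `o(1/k)`. -/
theorem summable_and_tendsto_of_abs_le {n : ℕ} (hn : 1 ≤ n) {c : ℕ → ℝ} {M : ℝ}
    (hc : ∀ k, |c k| ≤ M * k.factorial * √((k : ℝ) + 1)) :
    Summable (fun k => c k / risingProd n (k + 1)) ∧
      Tendsto (fun k : ℕ => ((k : ℝ) + 1) * (c k / risingProd n (k + 1))) atTop (𝓝 0) := by
  have hM : 0 ≤ M := by
    have := (abs_nonneg _).trans (hc 0)
    simpa using this
  have hb : ∀ k, |c k / risingProd n (k + 1)| ≤ M * (1 / ((k : ℝ) + 1) ^ 2 * √((k : ℝ) + 1)) := by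
    intro k
    rw [abs_div, abs_of_pos (risingProd_pos n _)]
    calc |c k| / risingProd n (k + 1)
        ≤ M * k.factorial * √((k : ℝ) + 1) / risingProd n (k + 1) := by
          gcongr
          · exact (risingProd_pos n _).le
          · exact hc k
      _ = M * (k.factorial / risingProd n (k + 1) * √((k : ℝ) + 1)) := by ring
      _ ≤ _ := by
          exact mul_le_mul_of_nonneg_left (mul_le_mul_of_nonneg_right
            (factorial_div_risingProd_succ_le hn k) (Real.sqrt_nonneg _)) hM
  refine ⟨.of_norm_bounded (summable_one_div_succ_sq_mul_sqrt.mul_left M) hb, ?_⟩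
  refine squeeze_zero_norm (fun k => ?_) (by simpa using tendsto_sqrt_succ_div.const_mul M)
  have hk : (0 : ℝ) < k + 1 := by positivity
  rw [norm_mul, Real.norm_of_nonneg hk.le]
  calc _ ≤ ((k : ℝ) + 1) * (M * (1 / ((k : ℝ) + 1) ^ 2 * √((k : ℝ) + 1))) := by
        gcongr; exact hb k
    _ = _ := by field_simp

/-- Weakens the bound available for a and b to the one that c also satisfies, so that one
convergence criterion serves all three. -/
theorem le_mul_factorial_sqrt {c : ℕ → ℝ} {M : ℝ} (hc : ∀ k, |c k| ≤ M * k.factorial) (k : ℕ) :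
    |c k| ≤ M * k.factorial * √((k : ℝ) + 1) := by
  refine (hc k).trans (le_mul_of_one_le_right ((abs_nonneg _).trans (hc k)) ?_)
  rw [Real.one_le_sqrt]
  linarith [(Nat.cast_nonneg k : (0 : ℝ) ≤ k)]

/-- The left side of `hrec` is x d_{k+1} plus the difference (k+2) d_{k+1} - (k+1) d_k. The
differences telescope, and their boundary term vanishes by `h0`. -/
theorem tsum_eq_of_telescoping {x : ℝ} {d s : ℕ → ℝ} (hd : Summable d) (hs : Summable s)
    (h0 : Tendsto (fun k : ℕ => ((k : ℝ) + 1) * d k) atTop (𝓝 0))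
    (hrec : ∀ k : ℕ, (x + k + 2) * d (k + 1) - (k + 1) * d k = s k) :
    ∑' k, s k = x * ∑' k, d k - (x + 1) * d 0 := by
  have hfin : ∀ K : ℕ, ∑ k ∈ Finset.range K, s k =
      x * (∑ k ∈ Finset.range (K + 1), d k - d 0) + (K + 1) * d K - d 0 := by
    intro K
    induction K with
    | zero => simp
    | succ K ih =>
      rw [Finset.sum_range_succ, ih, Finset.sum_range_succ _ (K + 1), ← hrec]
      push_cast
      ring
  have h1 := hs.hasSum.tendsto_sum_nat
  have h2 : Tendsto (fun K => ∑ k ∈ Finset.range (K + 1), d k) atTop (𝓝 (∑' k, d k)) :=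
    hd.hasSum.tendsto_sum_nat.comp (tendsto_add_atTop_nat 1)
  have h3 := (((h2.sub_const (d 0)).const_mul x).add h0).sub_const (d 0)
  rw [tendsto_nhds_unique h1 (h3.congr fun K => (hfin K).symm)]
  ring

/-- If `c_{k+2} = (k+1) c_{k+1} + a_{k+1}`, the inverse factorial series of `a` is that of `c`
multiplied by `n` and freed of its constant term. -/
theorem tsum_div_risingProd_eq {n : ℕ} {c a : ℕ → ℝ}
    (hrec : ∀ k : ℕ, c (k + 1) = (k + 1) * c k + a k)
    (hc : Summable (fun k => c k / risingProd n (k + 1)))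
    (h0 : Tendsto (fun k : ℕ => ((k : ℝ) + 1) * (c k / risingProd n (k + 1))) atTop (𝓝 0))
    (ha : Summable (fun k => a k / risingProd n (k + 1))) :
    ∑' k, a k / risingProd n (k + 1) = n * ∑' k, c k / risingProd n (k + 1) - c 0 := by
  rw [tsum_eq_of_telescoping (x := n) hc ha h0]
  · rw [risingProd_succ, risingProd_zero]
    have : (n : ℝ) + 1 ≠ 0 := by positivity
    push_cast
    field_simp
    ring
  · intro k
    have h1 := (risingProd_pos n (k + 1)).ne'
    have h2 : (n : ℝ) + k + 2 ≠ 0 := by positivity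
    rw [risingProd_succ n (k + 1), hrec]
    push_cast
    rw [show (n : ℝ) + (k + 1) + 1 = n + k + 2 by ring]
    field_simp
    ring

/-- After division by k! the increments are at most M/(k+1), so the growth is at most harmonic; the
square root is a convenient majorant that still leaves a convergent series. -/
theorem abs_le_of_recursion {c a : ℕ → ℝ} {M : ℝ} (ha : ∀ k, |a k| ≤ M * k.factorial)
    (hrec : ∀ k : ℕ, c (k + 1) = (k + 1) * c k + a k) (k : ℕ) :
    |c k| ≤ (|c 0| + 4 * M) * k.factorial * √((k : ℝ) + 1) := by
  have hM : 0 ≤ M := by simpa using (abs_nonneg _).trans (ha 0)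
  induction k with
  | zero => simpa using hM
  | succ k ih =>
    have hk : (0 : ℝ) ≤ k := Nat.cast_nonneg k
    set r := √((k : ℝ) + 1) with hr
    set t := √((k : ℝ) + 1 + 1) with ht
    have hr2 : r ^ 2 = k + 1 := Real.sq_sqrt (by linarith)
    have ht2 : t ^ 2 = k + 2 := by rw [ht, Real.sq_sqrt (by linarith)]; ring
    have hrt : r ≤ t := Real.sqrt_le_sqrt (by linarith)
    have hr1 : 1 ≤ r := Real.one_le_sqrt.mpr (by linarith)
    have ht1 : t ≤ 2 * r := by
      refine abs_le_of_sq_le_sq' ?_ (by linarith) |>.2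
      nlinarith
    -- Here t - r = 1/(t + r), and t + r ≤ 3r ≤ 3(k+1). This is the source of the constant 4.
    have hstep : 1 ≤ 4 * (k + 1) * (t - r) := by
      have h1 : (t - r) * (t + r) = 1 := by nlinarith
      have h2 : t + r ≤ 4 * (k + 1) := by nlinarith
      nlinarith [mul_le_mul_of_nonneg_left h2 (sub_nonneg.mpr hrt)]
    have hf : (0 : ℝ) < k.factorial := by positivity
    rw [hrec, Nat.factorial_succ]
    push_cast
    calc |(k + 1) * c k + a k| ≤ (k + 1) * |c k| + |a k| := by
          refine (abs_add_le _ _).trans_eq ?_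
          rw [abs_mul, abs_of_nonneg (show (0 : ℝ) ≤ k + 1 by linarith)]
      _ ≤ (k + 1) * ((|c 0| + 4 * M) * k.factorial * r) + M * k.factorial := by
          gcongr
          exact ha k
      _ ≤ (|c 0| + 4 * M) * ((k + 1) * k.factorial) * t := by
          have e1 : 0 ≤ M * k.factorial * (4 * (k + 1) * (t - r) - 1) :=
            mul_nonneg (by positivity) (by linarith)
          have e2 : 0 ≤ |c 0| * ((k + 1) * k.factorial) * (t - r) :=
            mul_nonneg (by positivity) (by linarith)
          nlinarith

/-! ### Inverse factorial expansion of 1/(n - iu) -/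

/-- `∏_{j=1}^k (j + iu)`. -/
noncomputable def verticalProd (k : ℕ) (u : ℝ) : ℂ :=
  ∏ j ∈ Finset.range k, ((j + 1 : ℂ) + u * Complex.I)

theorem verticalProd_succ (k : ℕ) (u : ℝ) :
    verticalProd (k + 1) u = verticalProd k u * ((k + 1 : ℂ) + u * Complex.I) :=
  Finset.prod_range_succ _ _

theorem continuous_verticalProd (k : ℕ) : Continuous (verticalProd k) := by
  unfold verticalProd
  fun_prop

theorem verticalProd_eq_stirlingSum (k : ℕ) (u : ℝ) :
    verticalProd k u = stirlingSum (fun p => (u * Complex.I) ^ p) k := by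
  induction k with
  | zero =>
    have : Nat.stirlingFirst 1 1 = 1 := rfl
    simp [verticalProd, stirlingSum, this]
  | succ k ih =>
    have h : stirlingSum (fun p => (u * Complex.I) ^ (p + 1)) k =
        (u * Complex.I) * stirlingSum (fun p => (u * Complex.I) ^ p) k := by
      simp only [stirlingSum, Finset.mul_sum]
      exact Finset.sum_congr rfl fun p _ => by ring
    rw [verticalProd_succ, stirlingSum_succ, h, ih]
    ring

theorem sinh_le_mul_exp (x : ℝ) : Real.sinh x ≤ x * Real.exp x := by
  have h := Real.add_one_le_exp (-(2 * x))
  have h2 : Real.exp (-x) = Real.exp x * Real.exp (-(2 * x)) := by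
    rw [← Real.exp_add]; ring_nf
  rw [Real.sinh_eq, h2]
  nlinarith [Real.exp_pos x]

/-- Euler's sine product at iu: the partial products increase to sinh(πu)/(πu). -/
theorem prod_one_add_sq_div_le {u : ℝ} (hu : 0 < u) (k : ℕ) :
    ∏ j ∈ Finset.range k, (1 + u ^ 2 / ((j : ℝ) + 1) ^ 2) ≤ Real.exp (Real.pi * u) := by
  have hpu : 0 < Real.pi * u := mul_pos Real.pi_pos hu
  have hlim : Tendsto (fun n : ℕ => Real.pi * u *
      ∏ j ∈ Finset.range n, (1 + u ^ 2 / ((j : ℝ) + 1) ^ 2)) atTop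
      (𝓝 (Real.sinh (Real.pi * u))) := by
    have h := (Complex.continuous_im.tendsto _).comp
      (Complex.tendsto_euler_sin_prod (u * Complex.I))
    have e : Complex.sin (Real.pi * (u * Complex.I)) =
        ((Real.sinh (Real.pi * u) : ℝ) : ℂ) * Complex.I := by
      rw [← mul_assoc, Complex.sin_mul_I]
      push_cast
      rfl
    rw [e, Complex.im_ofReal_mul, Complex.I_im, mul_one] at h
    refine h.congr fun n => ?_
    have e2 : (Real.pi : ℂ) * (u * Complex.I) *
        ∏ j ∈ Finset.range n, (1 - (u * Complex.I) ^ 2 / ((j : ℂ) + 1) ^ 2) =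
        ((Real.pi * u * ∏ j ∈ Finset.range n, (1 + u ^ 2 / ((j : ℝ) + 1) ^ 2) : ℝ) : ℂ) *
          Complex.I := by
      push_cast
      simp only [mul_pow, Complex.I_sq, mul_neg, mul_one, neg_div, sub_neg_eq_add]
      ring
    rw [Function.comp_apply, e2, Complex.im_ofReal_mul, Complex.I_im, mul_one]
  have hmono : Monotone (fun n : ℕ => Real.pi * u *
      ∏ j ∈ Finset.range n, (1 + u ^ 2 / ((j : ℝ) + 1) ^ 2)) := by
    refine monotone_nat_of_le_succ fun n => ?_
    rw [Finset.prod_range_succ]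
    refine mul_le_mul_of_nonneg_left (le_mul_of_one_le_right
      (Finset.prod_nonneg fun j _ => by positivity) ?_) hpu.le
    have : 0 ≤ u ^ 2 / ((n : ℝ) + 1) ^ 2 := by positivity
    linarith
  have := (hmono.ge_of_tendsto hlim k).trans (sinh_le_mul_exp _)
  exact le_of_mul_le_mul_left this hpu

theorem norm_verticalProd_le {u : ℝ} (hu : 0 < u) (k : ℕ) :
    ‖verticalProd k u‖ ≤ k.factorial * Real.exp (2 * u) := by
  refine abs_le_of_sq_le_sq' ?_ (by positivity) |>.2
  have h : ‖verticalProd k u‖ ^ 2 =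
      (k.factorial : ℝ) ^ 2 * ∏ j ∈ Finset.range k, (1 + u ^ 2 / ((j : ℝ) + 1) ^ 2) := by
    induction k with
    | zero => simp [verticalProd]
    | succ k ih =>
      have e : ‖(k + 1 : ℂ) + u * Complex.I‖ ^ 2 = ((k : ℝ) + 1) ^ 2 + u ^ 2 := by
        rw [Complex.sq_norm, Complex.normSq_apply]
        simp [sq]
      rw [verticalProd_succ, norm_mul, mul_pow, ih, e, Finset.prod_range_succ, Nat.factorial_succ]
      have : (k : ℝ) + 1 ≠ 0 := by positivity
      push_cast
      field_simp
  -- The squared norm is at most (k!)² e^(πu), and π ≤ 4 makes the exponential at most the square of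
  -- e^(2u).
  rw [h, mul_pow, ← Real.exp_nat_mul]
  gcongr
  refine (prod_one_add_sq_div_le hu k).trans (Real.exp_le_exp.mpr ?_)
  push_cast
  nlinarith [Real.pi_le_four]

theorem abs_re_verticalProd_le {u : ℝ} (hu : 0 < u) (k : ℕ) :
    |(verticalProd k u).re| ≤ k.factorial * Real.exp (3 * u) :=
  ((Complex.abs_re_le_norm _).trans (norm_verticalProd_le hu k)).trans
    (by gcongr; linarith)

/-- The extra factor costs u ≤ e^u, which is why the common rate is 3 and not 2. -/
theorem abs_re_mul_verticalProd_le {u : ℝ} (hu : 0 < u) (k : ℕ) :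
    |(u * Complex.I * verticalProd k u).re| ≤ k.factorial * Real.exp (3 * u) := by
  refine (Complex.abs_re_le_norm _).trans ?_
  rw [norm_mul, norm_mul, Complex.norm_I, mul_one, Complex.norm_real, Real.norm_of_nonneg hu.le]
  calc u * ‖verticalProd k u‖ ≤ Real.exp u * (k.factorial * Real.exp (2 * u)) := by
        gcongr
        · linarith [Real.add_one_le_exp u]
        · exact norm_verticalProd_le hu k
    _ = k.factorial * (Real.exp u * Real.exp (2 * u)) := by ring
    _ = _ := by rw [← Real.exp_add]; ring_nf

/-- Each step splits the remainder by n + K + 1 = (n - iu) + (K + 1 + iu). -/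
theorem sum_verticalProd_add_remainder {n : ℕ} (hn : 1 ≤ n) (u : ℝ) (K : ℕ) :
    ∑ k ∈ Finset.range K, verticalProd k u / (risingProd n (k + 1) : ℂ) +
      verticalProd K u / ((risingProd n K : ℂ) * (n - u * Complex.I)) =
      1 / (n - u * Complex.I) := by
  have hz : (n : ℂ) - u * Complex.I ≠ 0 := by
    intro h
    have := congrArg Complex.re h
    simp at this
    omega
  induction K with
  | zero => simp [verticalProd, risingProd_zero]
  | succ K ih =>
    rw [← ih, Finset.sum_range_succ, add_assoc, verticalProd_succ, risingProd_succ]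
    congr 1
    have h1 : (risingProd n K : ℂ) ≠ 0 := by exact_mod_cast (risingProd_pos n K).ne'
    have h2 : (n : ℂ) + K + 1 ≠ 0 := by exact_mod_cast (by positivity : (n : ℝ) + K + 1 ≠ 0)
    push_cast
    field_simp
    ring

/-- The remainder of the inverse factorial series of `n / (n² + u²)`. -/
theorem abs_sub_sum_re_verticalProd_le {n : ℕ} (hn : 1 ≤ n) {u : ℝ} (hu : 0 < u) (K : ℕ) :
    |n / ((n : ℝ) ^ 2 + u ^ 2) -
      ∑ k ∈ Finset.range K, (verticalProd k u).re / risingProd n (k + 1)| ≤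
      1 / (K + 1) * Real.exp (3 * u) := by
  have hn' : (1 : ℝ) ≤ n := by exact_mod_cast hn
  have h := congrArg Complex.re (sum_verticalProd_add_remainder hn u K)
  have e1 : (1 / ((n : ℂ) - u * Complex.I)).re = n / ((n : ℝ) ^ 2 + u ^ 2) := by
    rw [one_div, Complex.inv_re, Complex.normSq_apply]
    simp [sq]
  have e2 : (∑ k ∈ Finset.range K, verticalProd k u / (risingProd n (k + 1) : ℂ)).re =
      ∑ k ∈ Finset.range K, (verticalProd k u).re / risingProd n (k + 1) := by
    rw [Complex.re_sum]
    exact Finset.sum_congr rfl fun k _ => Complex.div_ofReal_re _ _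
  rw [Complex.add_re, e1, e2] at h
  rw [← h, add_sub_cancel_left]
  refine (Complex.abs_re_le_norm _).trans ?_
  have hz : 1 ≤ ‖(n : ℂ) - u * Complex.I‖ := by
    refine hn'.trans ((le_abs_self _).trans ?_)
    have := Complex.abs_re_le_norm ((n : ℂ) - u * Complex.I)
    simpa using this
  rw [norm_div, norm_mul, Complex.norm_real, Real.norm_of_nonneg (risingProd_pos n K).le]
  have hR := risingProd_pos n K
  calc _ ≤ (K.factorial * Real.exp (3 * u)) / (risingProd n K * 1) := by
        gcongr
        exact (norm_verticalProd_le hu K).trans (by gcongr; linarith)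
    _ = K.factorial / risingProd n K * Real.exp (3 * u) := by ring
    _ ≤ _ := mul_le_mul_of_nonneg_right (factorial_div_risingProd_le hn K) (Real.exp_pos _).le

/-! ### Weighted Laplace transforms and their moments -/

/-- `∫_0^∞ u^(-1/2) e^(-cu) g(u) du`. -/
noncomputable def laplaceHalf (c : ℝ) (g : ℝ → ℝ) : ℝ :=
  ∫ u in Ioi (0 : ℝ), u ^ (-1 / 2 : ℝ) * Real.exp (-(c * u)) * g u

theorem integrableOn_rpow_mul_exp_neg_mul {a c : ℝ} (ha : -1 < a) (hc : 0 < c) :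
    IntegrableOn (fun u : ℝ => u ^ a * Real.exp (-(c * u))) (Ioi 0) := by
  have h := integrableOn_rpow_mul_exp_neg_mul_rpow (p := 1) (s := a) (b := c) ha one_pos hc
  simpa only [Real.rpow_one, neg_mul] using h

/-- Exponential type at most `3`, with constant `M`. -/
structure ExpBounded (M : ℝ) (g : ℝ → ℝ) : Prop where
  continuous : Continuous g
  abs_le : ∀ u, 0 < u → |g u| ≤ M * Real.exp (3 * u)

/-- As c ≥ 6, the decay beats the rate 3 with e^(-3u) to spare. The majorant does not depend on c,
so it serves all frequencies at once. -/
theorem ExpBounded.norm_integrand_le {M : ℝ} {g : ℝ → ℝ} (hg : ExpBounded M g) {c : ℝ}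
    (hc : 6 ≤ c) {u : ℝ} (hu : 0 < u) :
    ‖u ^ (-1 / 2 : ℝ) * Real.exp (-(c * u)) * g u‖ ≤
      M * (u ^ (-1 / 2 : ℝ) * Real.exp (-(3 * u))) := by
  have hp : 0 < u ^ (-1 / 2 : ℝ) := Real.rpow_pos_of_pos hu _
  have hM : 0 ≤ M * Real.exp (3 * u) := (abs_nonneg _).trans (hg.abs_le u hu)
  rw [norm_mul, Real.norm_of_nonneg (by positivity), Real.norm_eq_abs]
  calc _ ≤ u ^ (-1 / 2 : ℝ) * Real.exp (-(6 * u)) * (M * Real.exp (3 * u)) := by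
        gcongr
        exact hg.abs_le u hu
    _ = M * (u ^ (-1 / 2 : ℝ) * (Real.exp (-(6 * u)) * Real.exp (3 * u))) := by ring
    _ = _ := by rw [← Real.exp_add]; ring_nf

theorem ExpBounded.integrableOn {M : ℝ} {g : ℝ → ℝ} (hg : ExpBounded M g) {c : ℝ} (hc : 6 ≤ c) :
    IntegrableOn (fun u : ℝ => u ^ (-1 / 2 : ℝ) * Real.exp (-(c * u)) * g u) (Ioi 0) := by
  refine Integrable.mono' ((integrableOn_rpow_mul_exp_neg_mul (a := -1 / 2) (c := 3)
    (by norm_num) (by norm_num)).const_mul M) ?_ ?_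
  · exact ((integrableOn_rpow_mul_exp_neg_mul (a := -1 / 2) (c := c)
      (by norm_num) (by linarith)).aestronglyMeasurable).mul hg.continuous.aestronglyMeasurable
  · filter_upwards [ae_restrict_mem measurableSet_Ioi] with u hu
    exact hg.norm_integrand_le hc hu

theorem ExpBounded.abs_laplaceHalf_le {M : ℝ} {g : ℝ → ℝ} (hg : ExpBounded M g) {c : ℝ}
    (hc : 6 ≤ c) : |laplaceHalf c g| ≤ M * laplaceHalf 3 (fun _ => 1) := by
  have h := norm_integral_le_of_norm_le (μ := volume.restrict (Ioi (0 : ℝ)))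
    (f := fun u : ℝ => u ^ (-1 / 2 : ℝ) * Real.exp (-(c * u)) * g u)
    ((integrableOn_rpow_mul_exp_neg_mul (a := -1 / 2) (c := 3)
    (by norm_num) (by norm_num)).const_mul M) (by
      filter_upwards [ae_restrict_mem measurableSet_Ioi] with u hu
      exact hg.norm_integrand_le hc hu)
  rw [integral_const_mul] at h
  simpa only [laplaceHalf, mul_one, Real.norm_eq_abs] using h

theorem laplaceHalf_sub {M N : ℝ} {g h : ℝ → ℝ} (hg : ExpBounded M g) (hh : ExpBounded N h)
    {c : ℝ} (hc : 6 ≤ c) :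
    laplaceHalf c (fun u => g u - h u) = laplaceHalf c g - laplaceHalf c h := by
  rw [laplaceHalf, laplaceHalf, laplaceHalf, ← integral_sub (hg.integrableOn hc) (hh.integrableOn hc)]
  simp only [mul_sub]

theorem ExpBounded.sum {ι : Type*} (s : Finset ι) {g : ι → ℝ → ℝ} {M : ι → ℝ}
    (hg : ∀ i, ExpBounded (M i) (g i)) (b : ι → ℝ) :
    ExpBounded (∑ i ∈ s, |b i| * M i) (fun u => ∑ i ∈ s, b i * g i u) where
  continuous := continuous_finsetSum _ fun i _ => continuous_const.mul (hg i).continuous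
  abs_le u hu := by
    rw [Finset.sum_mul]
    refine (Finset.abs_sum_le_sum_abs _ _).trans (Finset.sum_le_sum fun i _ => ?_)
    rw [abs_mul, mul_assoc]
    exact mul_le_mul_of_nonneg_left ((hg i).abs_le u hu) (abs_nonneg _)

theorem laplaceHalf_sum {ι : Type*} (s : Finset ι) {g : ι → ℝ → ℝ} {M : ι → ℝ}
    (hg : ∀ i, ExpBounded (M i) (g i)) (b : ι → ℝ) {c : ℝ} (hc : 6 ≤ c) :
    laplaceHalf c (fun u => ∑ i ∈ s, b i * g i u) = ∑ i ∈ s, b i * laplaceHalf c (g i) := by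
  simp only [laplaceHalf]
  simp_rw [← integral_const_mul]
  rw [← integral_finsetSum s fun i _ => ((hg i).integrableOn hc).const_mul (b i)]
  refine integral_congr_ae (Eventually.of_forall fun u => ?_)
  simp only [Finset.mul_sum]
  exact Finset.sum_congr rfl fun i _ => by ring

/-- The frequency `2π(m+1)`. -/
noncomputable def freq (m : ℕ) : ℝ := 2 * Real.pi * (m + 1)

theorem six_le_freq (m : ℕ) : 6 ≤ freq m := by
  have h := Real.pi_gt_three
  have : (0 : ℝ) ≤ m := Nat.cast_nonneg m
  unfold freq
  nlinarith

theorem freq_pos (m : ℕ) : 0 < freq m := by linarith [six_le_freq m]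

/-- `π^(-1/2) (2π(m+1))^(-3/2)`. -/
noncomputable def weight (m : ℕ) : ℝ := (√Real.pi)⁻¹ * (freq m) ^ (-3 / 2 : ℝ)

theorem weight_pos (m : ℕ) : 0 < weight m := by
  have := freq_pos m
  have := Real.pi_pos
  unfold weight
  positivity

theorem weight_eq (m : ℕ) : weight m =
    (√Real.pi)⁻¹ * (2 * Real.pi) ^ (-3 / 2 : ℝ) * (1 / ((m + 1 : ℕ) : ℝ) ^ (3 / 2 : ℝ)) := by
  rw [weight, freq, Real.mul_rpow (by positivity) (by positivity), one_div,
    ← Real.rpow_neg (by positivity)]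
  push_cast
  rw [show (-3 / 2 : ℝ) = -(3 / 2) by norm_num]
  ring

theorem summable_weight : Summable weight := by
  have h := (summable_nat_add_iff 1).mpr (Real.summable_one_div_nat_rpow.mpr
    (show (1 : ℝ) < 3 / 2 by norm_num))
  exact (h.mul_left ((√Real.pi)⁻¹ * (2 * Real.pi) ^ (-3 / 2 : ℝ))).congr fun m => (weight_eq m).symm

theorem laplaceHalf_pow {c : ℝ} (hc : 0 < c) (p : ℕ) :
    laplaceHalf c (fun u => u ^ p) = Real.Gamma (p + 1 / 2) * c ^ (-(p + 1 / 2) : ℝ) := by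
  have h := Real.integral_rpow_mul_exp_neg_mul_Ioi (a := p + 1 / 2) (r := c) (by positivity) hc
  rw [one_div c, Real.inv_rpow hc.le, ← Real.rpow_neg hc.le, mul_comm] at h
  rw [← h, laplaceHalf]
  refine setIntegral_congr_fun measurableSet_Ioi fun u (hu : 0 < u) => ?_
  rw [mul_right_comm, ← Real.rpow_natCast, ← Real.rpow_add hu]
  ring_nf

theorem re_mul_I_pow (u : ℝ) (p : ℕ) :
    ((u * Complex.I) ^ p).re = (Complex.I ^ p).re * u ^ p := by
  rw [mul_pow, ← Complex.ofReal_pow, Complex.re_ofReal_mul, mul_comm]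

theorem abs_re_I_pow_le (p : ℕ) : |(Complex.I ^ p).re| ≤ 1 := by
  refine (Complex.abs_re_le_norm _).trans ?_
  simp

theorem expBounded_re_mul_I_pow (p : ℕ) :
    ExpBounded p.factorial (fun u : ℝ => ((u * Complex.I) ^ p).re) where
  continuous := by fun_prop
  abs_le u hu := by
    rw [re_mul_I_pow, abs_mul, abs_of_pos (pow_pos hu p)]
    have h := Real.pow_div_factorial_le_exp u hu.le p
    rw [div_le_iff₀ (by positivity)] at h
    calc _ ≤ 1 * u ^ p := by gcongr; exact abs_re_I_pow_le p
      _ ≤ p.factorial * Real.exp u := by linarith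
      _ ≤ _ := by gcongr; linarith

theorem dfac_two_mul_sub_one (p : ℕ) :
    dfac (2 * (p : ℤ) - 1) = (Nat.doubleFactorial (2 * p - 1) : ℚ) := by
  cases p with
  | zero => simpa using dfac_neg_one
  | succ p =>
    have : (2 * ((p + 1 : ℕ) : ℤ) - 1) = ((2 * (p + 1) - 1 : ℕ) : ℤ) := by push_cast; omega
    rw [this]
    rfl

/-- The weight is designed for this: π^(-1/2) cancels the √π in Γ(p + 1/2), and the exponent -3/2
completes -(p + 1/2) to the integer -(p + 2). -/
theorem weight_mul_laplaceHalf_pow (m p : ℕ) :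
    weight m * laplaceHalf (freq m) (fun u => u ^ p) =
      (Nat.doubleFactorial (2 * p - 1) : ℝ) / (2 ^ p * (2 * Real.pi) ^ (p + 2)) *
        (1 / ((m + 1 : ℕ) : ℝ) ^ (p + 2)) := by
  have hc := freq_pos m
  have hpi := Real.pi_pos
  have e : (freq m) ^ (-3 / 2 : ℝ) * (freq m) ^ (-(p + 1 / 2) : ℝ) = 1 / (freq m) ^ (p + 2) := by
    rw [← Real.rpow_add hc, one_div (freq m ^ (p + 2)), ← Real.rpow_natCast,
      ← Real.rpow_neg hc.le]
    push_cast
    ring_nf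
  have hs : √Real.pi ≠ 0 := by positivity
  rw [laplaceHalf_pow hc, weight, Real.Gamma_nat_add_half]
  calc _ = (Nat.doubleFactorial (2 * p - 1) : ℝ) / 2 ^ p *
        ((freq m) ^ (-3 / 2 : ℝ) * (freq m) ^ (-(p + 1 / 2) : ℝ)) := by
        field_simp
    _ = _ := by
        rw [e, freq, mul_pow]
        push_cast
        field_simp

/-- The moments of the weighted Laplace transforms are the asymptotic coefficients. -/
theorem hasSum_moment (p : ℕ) :
    HasSum (fun m => weight m * laplaceHalf (freq m) (fun u => ((u * Complex.I) ^ p).re))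
      (alpha p) := by
  have h0 : ∀ m, weight m * laplaceHalf (freq m) (fun u => ((u * Complex.I) ^ p).re) =
      (Complex.I ^ p).re * ((Nat.doubleFactorial (2 * p - 1) : ℝ) /
        (2 ^ p * (2 * Real.pi) ^ (p + 2)) * (1 / ((m + 1 : ℕ) : ℝ) ^ (p + 2))) := by
    intro m
    have e : laplaceHalf (freq m) (fun u => ((u * Complex.I) ^ p).re) =
        (Complex.I ^ p).re * laplaceHalf (freq m) (fun u => u ^ p) := by
      simp only [laplaceHalf, ← integral_const_mul, re_mul_I_pow]
      refine integral_congr_ae (Eventually.of_forall fun u => ?_)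
      ring
    rw [← weight_mul_laplaceHalf_pow, e, mul_left_comm]
  simp only [h0]
  -- For p = 2q the sum is ζ(2q+2), and the sign in Euler's formula cancels Re i^(2q) = (-1)^q. For
  -- odd p both sides vanish, through Re i^p = 0 and B_{p+2} = 0.
  rcases Nat.even_or_odd' p with ⟨q, rfl | rfl⟩
  · have hz := hasSum_zeta_nat (k := q + 1) (by omega)
    rw [← hasSum_nat_add_iff' 1] at hz
    simp only [Finset.sum_range_one, Nat.cast_zero, ne_eq, mul_eq_zero, OfNat.ofNat_ne_zero,
      Nat.add_eq_zero_iff, one_ne_zero, and_false, or_self, not_false_eq_true, zero_pow, div_zero,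
      sub_zero] at hz
    have hI : (Complex.I ^ (2 * q)).re = (-1) ^ q := by
      rw [pow_mul, Complex.I_sq]
      exact_mod_cast Complex.ofReal_re ((-1 : ℝ) ^ q)
    rw [hI]
    have h1 := (hz.mul_left ((Nat.doubleFactorial (2 * (2 * q) - 1) : ℝ) /
        (2 ^ (2 * q) * (2 * Real.pi) ^ (2 * q + 2)))).mul_left ((-1 : ℝ) ^ q)
    suffices h2 : alpha (2 * q) = _ from h2 ▸ h1
    rw [alpha, dfac_two_mul_sub_one]
    have hpi := Real.pi_pos.ne'
    have hs : ((-1 : ℝ) ^ q) * (-1) ^ (q + 1 + 1) = 1 := by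
      rw [← pow_add]; exact Even.neg_one_pow ⟨q + 1, by ring⟩
    rw [show 2 * (q + 1) - 1 = 2 * q + 1 by omega, show 2 * (q + 1) = 2 * q + 2 by ring]
    push_cast
    have : ∀ X Y Z W : ℝ, (-1 : ℝ) ^ q * (X * ((-1) ^ (q + 1 + 1) * Y * Z * W /
        ((2 * q + 2).factorial : ℝ))) = X * (Y * Z * W / ((2 * q + 2).factorial : ℝ)) := by
      intro X Y Z W
      linear_combination X * (Y * Z * W / ((2 * q + 2).factorial : ℝ)) * hs
    rw [this, mul_pow]
    field_simp
    ring
  · have hI : (Complex.I ^ (2 * q + 1)).re = 0 := by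
      rw [pow_succ, pow_mul, Complex.I_sq]
      have : ((-1 : ℂ) ^ q) = (((-1 : ℝ) ^ q : ℝ) : ℂ) := by push_cast; rfl
      rw [this, Complex.re_ofReal_mul, Complex.I_re, mul_zero]
    have hB : bernoulli (2 * q + 1 + 2) = 0 :=
      bernoulli_eq_zero_of_odd ⟨q + 1, by ring⟩ (by omega)
    simp only [hI, zero_mul, alpha, hB, mul_zero, Rat.cast_zero]
    exact hasSum_zero

/-- The case r = 0 yields the coefficients a, and r = 1 the coefficients b. -/
theorem hasSum_stirlingSum (r k : ℕ) :
    HasSum (fun m => weight m *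
        laplaceHalf (freq m) (fun u => ((u * Complex.I) ^ r * verticalProd k u).re))
      (stirlingSum (fun p => alpha (p + r)) k) := by
  have h : ∀ u : ℝ, ((u * Complex.I) ^ r * verticalProd k u).re =
      ∑ p ∈ Finset.range (k + 1), (Nat.stirlingFirst (k + 1) (p + 1) : ℝ) *
        ((u * Complex.I) ^ (p + r)).re := by
    intro u
    rw [verticalProd_eq_stirlingSum, stirlingSum, Finset.mul_sum, Complex.re_sum]
    refine Finset.sum_congr rfl fun p _ => ?_
    rw [← Complex.re_ofReal_mul, pow_add]
    congr 1
    push_cast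
    ring
  simp only [h]
  refine (hasSum_sum (s := Finset.range (k + 1)) fun p _ =>
    (hasSum_moment (p + r)).mul_left (Nat.stirlingFirst (k + 1) (p + 1) : ℝ)).congr_fun ?_
  intro m
  rw [laplaceHalf_sum _ (fun p => expBounded_re_mul_I_pow (p + r)) _ (six_le_freq m),
    Finset.mul_sum]
  exact Finset.sum_congr rfl fun p _ => by ring

/-- Linear in M with a universal constant: it bounds the coefficients when M = k!, and the remainder
of the series when M = 1/(K+1). -/
theorem abs_le_of_hasSum_laplaceHalf {g : ℝ → ℝ} {M a : ℝ} (hg : ExpBounded M g)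
    (h : HasSum (fun m => weight m * laplaceHalf (freq m) g) a) :
    |a| ≤ (∑' m, weight m) * laplaceHalf 3 (fun _ => 1) * M := by
  have hb := summable_weight.hasSum.mul_right (laplaceHalf 3 (fun _ => 1) * M)
  rw [mul_assoc]
  refine h.norm_le_of_bounded hb fun m => ?_
  rw [norm_mul, Real.norm_of_nonneg (weight_pos m).le, Real.norm_eq_abs]
  refine mul_le_mul_of_nonneg_left ?_ (weight_pos m).le
  rw [mul_comm]
  exact hg.abs_laplaceHalf_le (six_le_freq m)

theorem expBounded_re_verticalProd (k : ℕ) :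
    ExpBounded k.factorial (fun u => (verticalProd k u).re) where
  continuous := Complex.continuous_re.comp (continuous_verticalProd k)
  abs_le _ hu := abs_re_verticalProd_le hu k

theorem expBounded_re_mul_verticalProd (k : ℕ) :
    ExpBounded k.factorial (fun u : ℝ => (u * Complex.I * verticalProd k u).re) where
  continuous := by
    have := continuous_verticalProd k
    fun_prop
  abs_le _ hu := abs_re_mul_verticalProd_le hu k

theorem hasSum_coeffA (k : ℕ) :
    HasSum (fun m => weight m * laplaceHalf (freq m) (fun u => (verticalProd k u).re))
      (coeffA (k + 1) : ℝ) := by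
  simpa [coeffA_succ] using hasSum_stirlingSum 0 k

theorem exists_abs_coeff_le : ∃ M : ℝ, (∀ k : ℕ, |(coeffA (k + 1) : ℝ)| ≤ M * k.factorial) ∧
    ∀ k : ℕ, |(coeffB (k + 1) : ℝ)| ≤ M * k.factorial := by
  refine ⟨(∑' m, weight m) * laplaceHalf 3 (fun _ => 1), fun k => ?_, fun k => ?_⟩
  · exact abs_le_of_hasSum_laplaceHalf (expBounded_re_verticalProd k) (hasSum_coeffA k)
  · refine abs_le_of_hasSum_laplaceHalf (expBounded_re_mul_verticalProd k) ?_
    simpa [coeffB_succ] using hasSum_stirlingSum 1 k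

/-- The first inverse factorial series represents the weighted Laplace transforms of
`n / (n² + u²)`. -/
theorem hasSum_coeffA_div_risingProd {n : ℕ} (hn : 1 ≤ n) {D : ℝ}
    (hD : HasSum (fun m => weight m *
      laplaceHalf (freq m) (fun u => n / ((n : ℝ) ^ 2 + u ^ 2))) D) :
    HasSum (fun k : ℕ => (coeffA (k + 1) : ℝ) / risingProd n (k + 1)) D := by
  obtain ⟨M, hM, -⟩ := exists_abs_coeff_le
  have hsum := (summable_and_tendsto_of_abs_le hn (le_mul_factorial_sqrt hM)).1
  refine (hsum.hasSum_iff_tendsto_nat).mpr ?_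
  have hn' : (1 : ℝ) ≤ n := by exact_mod_cast hn
  have hker : ExpBounded 1 (fun u : ℝ => n / ((n : ℝ) ^ 2 + u ^ 2)) := by
    refine ⟨?_, fun u hu => ?_⟩
    · refine continuous_const.div (by fun_prop) fun u => ?_
      positivity
    · rw [abs_of_nonneg (by positivity), one_mul]
      have h1 : (n : ℝ) / ((n : ℝ) ^ 2 + u ^ 2) ≤ 1 := by
        rw [div_le_one (by positivity)]
        nlinarith [sq_nonneg u]
      exact h1.trans (Real.one_le_exp (by positivity))
  -- The difference is the weighted transform of the kernel minus its K-term expansion, and that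
  -- function is at most e^(3u)/(K+1).
  have hpart : ∀ K : ℕ, |D - ∑ k ∈ Finset.range K, (coeffA (k + 1) : ℝ) / risingProd n (k + 1)| ≤
      (∑' m, weight m) * laplaceHalf 3 (fun _ => 1) * (1 / (K + 1)) := by
    intro K
    have hS := ExpBounded.sum (Finset.range K) expBounded_re_verticalProd
      (fun k => (risingProd n (k + 1))⁻¹)
    have hfun : ∀ u : ℝ, ∑ k ∈ Finset.range K, (risingProd n (k + 1))⁻¹ * (verticalProd k u).re =
        ∑ k ∈ Finset.range K, (verticalProd k u).re / risingProd n (k + 1) := fun u =>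
      Finset.sum_congr rfl fun k _ => by rw [div_eq_inv_mul]
    refine abs_le_of_hasSum_laplaceHalf (g := fun u => n / ((n : ℝ) ^ 2 + u ^ 2) -
      ∑ k ∈ Finset.range K, (risingProd n (k + 1))⁻¹ * (verticalProd k u).re)
      ⟨hker.continuous.sub hS.continuous, fun u hu => ?_⟩ ?_
    · rw [hfun]
      exact abs_sub_sum_re_verticalProd_le hn hu K
    · refine (hD.sub (hasSum_sum (s := Finset.range K) fun k _ =>
        (hasSum_coeffA k).div_const (risingProd n (k + 1)))).congr_fun ?_
      intro m
      rw [laplaceHalf_sub hker hS (six_le_freq m),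
        laplaceHalf_sum _ expBounded_re_verticalProd _ (six_le_freq m), mul_sub, Finset.mul_sum]
      congr 1
      exact Finset.sum_congr rfl fun k _ => by ring
  have hlim : Tendsto (fun K : ℕ => (∑' m, weight m) * laplaceHalf 3 (fun _ => 1) *
      (1 / ((K : ℝ) + 1))) atTop (𝓝 0) := by
    simpa using tendsto_one_div_add_atTop_nhds_zero_nat.const_mul
      ((∑' m, weight m) * laplaceHalf 3 (fun _ => 1))
  have h0 := squeeze_zero_norm (f := fun K => D - ∑ k ∈ Finset.range K,
    (coeffA (k + 1) : ℝ) / risingProd n (k + 1)) hpart hlim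
  simpa using h0.const_sub D

/-! ### The cotangent series and the trapezoidal kernel -/

/-- `∑_{m ≥ 1} 1 / (s² + (2πm)²)`. -/
noncomputable def poleSum (s : ℝ) : ℝ := ∑' m, 1 / (s ^ 2 + freq m ^ 2)

theorem poleSum_eq {s : ℝ} (hs : 0 < s) :
    poleSum s = 1 / (4 * s) * ((1 + Real.exp (-s)) / (1 - Real.exp (-s)) - 2 / s) := by
  have hpi := Real.pi_pos
  have hpiC : (Real.pi : ℂ) ≠ 0 := by exact_mod_cast hpi.ne'
  have hsC : (s : ℂ) ≠ 0 := by exact_mod_cast hs.ne'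
  -- At x = is/(2π) one has x² - (m+1)² = -(s² + (2π(m+1))²)/(4π²), so the partial fractions of π
  -- cot(πx) give the terms of `poleSum`, and e^(2πix) = e^(-s).
  set x : ℂ := s / (2 * Real.pi) * Complex.I with hx
  have hxim : x.im = s / (2 * Real.pi) := by
    have : x = ((s / (2 * Real.pi) : ℝ) : ℂ) * Complex.I := by rw [hx]; push_cast; rfl
    rw [this, Complex.im_ofReal_mul, Complex.I_im, mul_one]
  have hmem : x ∈ Complex.integerComplement := by
    rintro ⟨k, hk⟩
    have := congrArg Complex.im hk
    rw [hxim, Complex.intCast_im] at this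
    have : 0 < s / (2 * Real.pi) := by positivity
    linarith
  have hterm : ∀ m : ℕ, 1 / (x - (m + 1)) + 1 / (x + (m + 1)) =
      (-(4 * Real.pi * s) * Complex.I) * ((1 / (s ^ 2 + freq m ^ 2) : ℝ) : ℂ) := by
    intro m
    have h1 : x - (m + 1) ≠ 0 := fun h => by
      have := congrArg Complex.im h
      simp [hxim] at this
      rcases this with h | h
      all_goals linarith
    have h2 : x + (m + 1) ≠ 0 := fun h => by
      have := congrArg Complex.im h
      simp [hxim] at this
      rcases this with h | h
      all_goals linarith
    have h3 : (s : ℂ) ^ 2 + (2 * Real.pi * (m + 1)) ^ 2 ≠ 0 := by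
      have : s ^ 2 + (2 * Real.pi * (m + 1)) ^ 2 ≠ 0 := by positivity
      exact_mod_cast this
    have h4 : (s : ℂ) ^ 2 + (2 * Real.pi * (m + 1)) ^ 2 =
        -(4 * Real.pi ^ 2) * ((x - (m + 1)) * (x + (m + 1))) := by
      have : x ^ 2 = -(s ^ 2 / (4 * Real.pi ^ 2)) := by
        rw [hx, mul_pow, Complex.I_sq]; field_simp; norm_num
      have e : (x - (m + 1)) * (x + (m + 1)) = x ^ 2 - (m + 1) ^ 2 := by ring
      rw [e, this]
      field_simp
      ring
    have h5 : 1 / (x - (m + 1)) + 1 / (x + (m + 1)) = 2 * x / ((x - (m + 1)) * (x + (m + 1))) := by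
      field_simp
      ring
    rw [h5, freq]
    push_cast
    rw [h4, hx]
    have h6 := mul_ne_zero h1 h2
    rw [← hx]
    field_simp
    rw [hx]
    field_simp
  have hcot := cot_series_rep' hmem
  simp only [hterm] at hcot
  rw [tsum_mul_left, ← Complex.ofReal_tsum, Complex.cot_eq_exp_ratio] at hcot
  have hexp : Complex.exp (2 * Complex.I * (Real.pi * x)) = ((Real.exp (-s) : ℝ) : ℂ) := by
    rw [Complex.ofReal_exp]
    congr 1
    rw [hx]
    push_cast
    field_simp
    rw [Complex.I_sq]
  have hE : 1 - Real.exp (-s) ≠ 0 := by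
    have : Real.exp (-s) < 1 := by simpa using hs
    linarith
  have hEC : (1 : ℂ) - (Real.exp (-s) : ℝ) ≠ 0 := by exact_mod_cast hE
  rw [hexp] at hcot
  change _ = (-(4 * Real.pi * s) * Complex.I) * ((poleSum s : ℝ) : ℂ) at hcot
  have hfin : ((poleSum s : ℝ) : ℂ) =
      ((1 / (4 * s) * ((1 + Real.exp (-s)) / (1 - Real.exp (-s)) - 2 / s) : ℝ) : ℂ) := by
    have hc : (-(4 * Real.pi * s) * Complex.I) ≠ 0 := by
      simp [hpi.ne', hs.ne']
    apply mul_left_cancel₀ hc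
    rw [← hcot, hx]
    set E := Real.exp (-s)
    push_cast
    have hI := Complex.I_ne_zero
    field_simp
    rw [Complex.I_sq]
    ring
  exact_mod_cast hfin

theorem integral_half_sub_mul_exp {s : ℝ} (hs : 0 < s) :
    ∫ t in (0 : ℝ)..1, (1 / 2 - t) * Real.exp (-(t * s)) =
      (1 + Real.exp (-s)) / (2 * s) - (1 - Real.exp (-s)) / s ^ 2 := by
  have hd : ∀ t ∈ uIcc (0 : ℝ) 1, HasDerivAt
      (fun t : ℝ => ((t - 1 / 2) / s + 1 / s ^ 2) * Real.exp (-(t * s)))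
      ((1 / 2 - t) * Real.exp (-(t * s))) t := by
    intro t _
    have h1 : HasDerivAt (fun t : ℝ => (t - 1 / 2) / s + 1 / s ^ 2) (1 / s) t :=
      (((hasDerivAt_id t).sub_const _).div_const s).add_const _
    have h2 : HasDerivAt (fun t : ℝ => Real.exp (-(t * s))) (Real.exp (-(t * s)) * (-(1 * s))) t :=
      ((hasDerivAt_id t).mul_const s).neg.exp
    convert! h1.mul h2 using 1
    field_simp
    ring
  rw [intervalIntegral.integral_eq_sub_of_hasDerivAt hd
    (Continuous.intervalIntegrable (by fun_prop) _ _)]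
  simp only [zero_mul, neg_zero, Real.exp_zero, one_mul]
  field_simp
  ring

/-- The factor 1 - e^(-s) clears the denominator of the closed form; it arises as e^(-ns) -
e^(-(n+1)s) divided by e^(-ns). -/
theorem one_sub_exp_mul_poleSum {s : ℝ} (hs : 0 < s) :
    (1 - Real.exp (-s)) * poleSum s =
      1 / 2 * ∫ t in (0 : ℝ)..1, (1 / 2 - t) * Real.exp (-(t * s)) := by
  have hE : 1 - Real.exp (-s) ≠ 0 := by
    have : Real.exp (-s) < 1 := by simpa using hs
    linarith
  rw [poleSum_eq hs, integral_half_sub_mul_exp hs]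
  field_simp
  ring

/-! ### The integral of s^(-1/2)/(s² + c²) -/

/-- An antiderivative of `2 / (1 + q⁴)`. -/
noncomputable def quarticPrimitive (q : ℝ) : ℝ :=
  1 / √2 * (Real.arctan (√2 * q + 1) + Real.arctan (√2 * q - 1)) +
    1 / (2 * √2) * (Real.log (q ^ 2 + √2 * q + 1) - Real.log (q ^ 2 - √2 * q + 1))

theorem quartic_factor_pos (q : ℝ) : 0 < q ^ 2 + √2 * q + 1 ∧ 0 < q ^ 2 - √2 * q + 1 := by
  have h : √2 ^ 2 = 2 := Real.sq_sqrt (by norm_num)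
  constructor
  · nlinarith [sq_nonneg (q + √2 / 2)]
  · nlinarith [sq_nonneg (q - √2 / 2)]

/-- Partial fractions over 1 + q⁴ = (q² + √2 q + 1)(q² - √2 q + 1). -/
theorem hasDerivAt_quarticPrimitive (q : ℝ) :
    HasDerivAt quarticPrimitive (2 / (1 + q ^ 4)) q := by
  obtain ⟨hp, hm⟩ := quartic_factor_pos q
  have h2 : √2 ^ 2 = 2 := Real.sq_sqrt (by norm_num)
  have hs : √2 ≠ 0 := by positivity
  have d0 : HasDerivAt (fun q : ℝ => √2 * q) (√2 * 1) q := (hasDerivAt_id q).const_mul _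
  have d1 := (d0.add_const 1).arctan
  have d2 := (d0.sub_const 1).arctan
  have dq : HasDerivAt (fun q : ℝ => q ^ 2) (2 * q) q := by simpa using hasDerivAt_pow 2 q
  have d3 := ((dq.add d0).add_const 1).log hp.ne'
  have d4 := ((dq.sub d0).add_const 1).log hm.ne'
  have h := ((d1.add d2).const_mul (1 / √2)).add ((d3.sub d4).const_mul (1 / (2 * √2)))
  refine HasDerivAt.congr_deriv (f := quarticPrimitive) h ?_
  simp only [Pi.add_apply, Pi.sub_apply]
  have e1 : 1 + (√2 * q + 1) ^ 2 = 2 * (q ^ 2 + √2 * q + 1) := by linear_combination q ^ 2 * h2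
  have e2 : 1 + (√2 * q - 1) ^ 2 = 2 * (q ^ 2 - √2 * q + 1) := by linear_combination q ^ 2 * h2
  have e3 : 1 + q ^ 4 = (q ^ 2 + √2 * q + 1) * (q ^ 2 - √2 * q + 1) := by
    linear_combination q ^ 2 * h2
  rw [e1, e2, e3]
  clear h d3 d4 e1 e2 e3
  generalize hA : q ^ 2 + √2 * q + 1 = A at *
  generalize hN : q ^ 2 - √2 * q + 1 = N at *
  field_simp
  linear_combination (-(2 * √2 - 2 * q)) * hA - (2 * √2 + 2 * q) * hN

theorem tendsto_quarticPrimitive : Tendsto quarticPrimitive atTop (𝓝 (Real.pi / √2)) := by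
  have h2 : 0 < √2 := by positivity
  have l0 : Tendsto (fun q : ℝ => √2 * q) atTop atTop := tendsto_id.const_mul_atTop h2
  have l1 : Tendsto (fun q : ℝ => Real.arctan (√2 * q + 1)) atTop (𝓝 (Real.pi / 2)) :=
    (Real.tendsto_arctan_atTop.mono_right nhdsWithin_le_nhds).comp
      (tendsto_atTop_add_const_right _ _ l0)
  have l2 : Tendsto (fun q : ℝ => Real.arctan (√2 * q - 1)) atTop (𝓝 (Real.pi / 2)) :=
    (Real.tendsto_arctan_atTop.mono_right nhdsWithin_le_nhds).comp
      (tendsto_atTop_add_const_right _ (-1) l0)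
  have l3 : Tendsto (fun q : ℝ => Real.log (q ^ 2 + √2 * q + 1) - Real.log (q ^ 2 - √2 * q + 1))
      atTop (𝓝 0) := by
    have hi : Tendsto (fun q : ℝ => q⁻¹) atTop (𝓝 0) := tendsto_inv_atTop_zero
    have hnum : Tendsto (fun q : ℝ => 1 + √2 * q⁻¹ + q⁻¹ * q⁻¹) atTop (𝓝 (1 + √2 * 0 + 0 * 0)) :=
      (tendsto_const_nhds.add (hi.const_mul _)).add (hi.mul hi)
    have hden : Tendsto (fun q : ℝ => 1 - √2 * q⁻¹ + q⁻¹ * q⁻¹) atTop (𝓝 (1 - √2 * 0 + 0 * 0)) :=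
      (tendsto_const_nhds.sub (hi.const_mul _)).add (hi.mul hi)
    have hl := (hnum.log (by norm_num)).sub (hden.log (by norm_num))
    simp only [mul_zero, add_zero, sub_zero, Real.log_one] at hl
    refine hl.congr' ?_
    filter_upwards [eventually_gt_atTop 0] with q hq
    obtain ⟨hp, hm⟩ := quartic_factor_pos q
    have e1 : 1 + √2 * q⁻¹ + q⁻¹ * q⁻¹ = (q ^ 2 + √2 * q + 1) / q ^ 2 := by field_simp
    have e2 : 1 - √2 * q⁻¹ + q⁻¹ * q⁻¹ = (q ^ 2 - √2 * q + 1) / q ^ 2 := by field_simp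
    rw [e1, e2, Real.log_div hp.ne' (by positivity), Real.log_div hm.ne' (by positivity)]
    ring
  have h := ((l1.add l2).const_mul (1 / √2)).add (l3.const_mul (1 / (2 * √2)))
  refine (h.congr fun q => rfl).trans_eq ?_
  congr 1
  ring

/-- The substitution v = q² reduces this to 2/(1 + q⁴). The integrand is nonnegative, so the finite
limit of the primitive also gives integrability. -/
theorem integral_rpow_div_one_add_sq :
    IntegrableOn (fun v : ℝ => v ^ (-1 / 2 : ℝ) / (1 + v ^ 2)) (Ioi 0) ∧
      ∫ v in Ioi (0 : ℝ), v ^ (-1 / 2 : ℝ) / (1 + v ^ 2) = Real.pi / √2 := by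
  have hcont : ContinuousWithinAt (fun v => quarticPrimitive √v) (Ici 0) 0 := by
    have hq : Continuous quarticPrimitive :=
      continuous_iff_continuousAt.mpr fun q => (hasDerivAt_quarticPrimitive q).continuousAt
    exact (hq.comp Real.continuous_sqrt).continuousWithinAt
  have hder : ∀ v ∈ Ioi (0 : ℝ), HasDerivAt (fun v => quarticPrimitive √v)
      (v ^ (-1 / 2 : ℝ) / (1 + v ^ 2)) v := by
    intro v (hv : 0 < v)
    have h := (hasDerivAt_quarticPrimitive √v).comp v (Real.hasDerivAt_sqrt hv.ne')
    refine h.congr_deriv ?_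
    have e : √v ^ 4 = v ^ 2 := by
      rw [show √v ^ 4 = (√v ^ 2) ^ 2 by ring, Real.sq_sqrt hv.le]
    have e2 : v ^ (-1 / 2 : ℝ) = (√v)⁻¹ := by
      rw [Real.sqrt_eq_rpow, ← Real.rpow_neg hv.le]
      norm_num
    have : 0 < √v := Real.sqrt_pos.mpr hv
    rw [e, e2]
    field_simp
  have hpos : ∀ v ∈ Ioi (0 : ℝ), 0 ≤ v ^ (-1 / 2 : ℝ) / (1 + v ^ 2) := by
    intro v (hv : 0 < v)
    positivity
  have hlim := tendsto_quarticPrimitive.comp Real.tendsto_sqrt_atTop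
  refine ⟨integrableOn_Ioi_deriv_of_nonneg hcont hder hpos hlim, ?_⟩
  rw [integral_Ioi_of_hasDerivAt_of_nonneg hcont hder hpos hlim]
  simp [quarticPrimitive, Real.arctan_neg]

theorem rpow_div_scale {c v : ℝ} (hc : 0 < c) (hv : 0 < v) :
    (c * v) ^ (-1 / 2 : ℝ) * (1 / ((c * v) ^ 2 + c ^ 2)) =
      c ^ (-5 / 2 : ℝ) * (v ^ (-1 / 2 : ℝ) / (1 + v ^ 2)) := by
  have e : c ^ (-5 / 2 : ℝ) = c ^ (-1 / 2 : ℝ) * (c ^ 2)⁻¹ := by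
    rw [← Real.rpow_natCast, ← Real.rpow_neg hc.le, ← Real.rpow_add hc]
    norm_num
  rw [Real.mul_rpow hc.le hv.le, e]
  field_simp
  ring

theorem integral_rpow_div_sq_add_sq {c : ℝ} (hc : 0 < c) :
    IntegrableOn (fun s : ℝ => s ^ (-1 / 2 : ℝ) * (1 / (s ^ 2 + c ^ 2))) (Ioi 0) ∧
      ∫ s in Ioi (0 : ℝ), s ^ (-1 / 2 : ℝ) * (1 / (s ^ 2 + c ^ 2)) =
        c ^ (-3 / 2 : ℝ) * (Real.pi / √2) := by
  obtain ⟨hi, he⟩ := integral_rpow_div_one_add_sq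
  constructor
  · have h := integrableOn_Ioi_comp_mul_left_iff
      (fun s : ℝ => s ^ (-1 / 2 : ℝ) * (1 / (s ^ 2 + c ^ 2))) 0 hc
    rw [mul_zero] at h
    refine h.mp (IntegrableOn.congr_fun (hi.const_mul (c ^ (-5 / 2 : ℝ)))
      (fun v hv => ?_) measurableSet_Ioi)
    exact (rpow_div_scale hc hv).symm
  · have h := integral_comp_mul_left_Ioi
      (fun s : ℝ => s ^ (-1 / 2 : ℝ) * (1 / (s ^ 2 + c ^ 2))) 0 hc
    rw [mul_zero, smul_eq_mul] at h
    have h2 : ∫ v in Ioi (0 : ℝ), (c * v) ^ (-1 / 2 : ℝ) * (1 / ((c * v) ^ 2 + c ^ 2)) =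
        c ^ (-5 / 2 : ℝ) * (Real.pi / √2) := by
      rw [← he, ← integral_const_mul]
      exact setIntegral_congr_fun measurableSet_Ioi fun v hv => rpow_div_scale hc hv
    have e : c ^ (-3 / 2 : ℝ) = c * c ^ (-5 / 2 : ℝ) := by
      rw [← Real.rpow_one_add' hc.le (by norm_num)]
      norm_num
    rw [h2] at h
    rw [e, mul_assoc, h, mul_inv_cancel_left₀ hc.ne']

theorem integrableOn_rpow_mul_div_sq_add_sq {c : ℝ} (hc : 0 < c) {w : ℝ → ℝ} (hw : Continuous w)
    (hw1 : ∀ s, 0 < s → |w s| ≤ 1) :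
    IntegrableOn (fun s : ℝ => s ^ (-1 / 2 : ℝ) * w s * (1 / (s ^ 2 + c ^ 2))) (Ioi 0) ∧
      ∫ s in Ioi (0 : ℝ), ‖s ^ (-1 / 2 : ℝ) * w s * (1 / (s ^ 2 + c ^ 2))‖ ≤
        c ^ (-3 / 2 : ℝ) * (Real.pi / √2) := by
  obtain ⟨hi, he⟩ := integral_rpow_div_sq_add_sq hc
  have hb : ∀ s ∈ Ioi (0 : ℝ), ‖s ^ (-1 / 2 : ℝ) * w s * (1 / (s ^ 2 + c ^ 2))‖ ≤
      s ^ (-1 / 2 : ℝ) * (1 / (s ^ 2 + c ^ 2)) := by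
    intro s (hs : 0 < s)
    rw [mul_right_comm, norm_mul, Real.norm_of_nonneg (by positivity), Real.norm_eq_abs]
    exact mul_le_of_le_one_right (by positivity) (hw1 s hs)
  have hint : IntegrableOn (fun s : ℝ => s ^ (-1 / 2 : ℝ) * w s * (1 / (s ^ 2 + c ^ 2)))
      (Ioi 0) := by
    refine Integrable.mono' hi ?_ ((ae_restrict_iff' measurableSet_Ioi).mpr (.of_forall hb))
    refine (hi.aestronglyMeasurable.mul hw.aestronglyMeasurable).congr (.of_forall fun s => ?_)
    simp only [Pi.mul_apply]
    ring
  refine ⟨hint, ?_⟩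
  rw [← he]
  exact setIntegral_mono_on hint.norm hi measurableSet_Ioi hb

/-! ### The remainder integral, its value at 0 and its rescaling -/

/-- The exchange is allowed because the m-th norm integral is at most a constant times (m+1)^(-3/2).
-/
theorem hasSum_integral_div_sq_add_freq_sq {w : ℝ → ℝ} (hw : Continuous w)
    (hw1 : ∀ s, 0 < s → |w s| ≤ 1) :
    HasSum (fun m => ∫ s in Ioi (0 : ℝ), s ^ (-1 / 2 : ℝ) * w s * (1 / (s ^ 2 + freq m ^ 2)))
      (∫ s in Ioi (0 : ℝ), s ^ (-1 / 2 : ℝ) * w s * poleSum s) := by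
  have hsum : Summable fun m => (freq m) ^ (-3 / 2 : ℝ) * (Real.pi / √2) := by
    have hpi := Real.pi_pos
    have hs : √Real.pi ≠ 0 := by positivity
    refine (summable_weight.mul_left (√Real.pi * (Real.pi / √2))).congr fun m => ?_
    rw [weight]
    field_simp
  have h := hasSum_integral_of_summable_integral_norm (μ := volume.restrict (Ioi (0 : ℝ)))
    (F := fun m s => s ^ (-1 / 2 : ℝ) * w s * (1 / (s ^ 2 + freq m ^ 2)))
    (fun m => (integrableOn_rpow_mul_div_sq_add_sq (freq_pos m) hw hw1).1)
    (Summable.of_nonneg_of_le (fun m => integral_nonneg fun s => norm_nonneg _)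
      (fun m => (integrableOn_rpow_mul_div_sq_add_sq (freq_pos m) hw hw1).2) hsum)
  simp only [tsum_mul_left] at h
  exact h

/-- The remainder integral `π^(-1/2) ∫_0^∞ s^(-1/2) e^(-ns) ∑_m 1/(s² + (2πm)²) ds`. -/
noncomputable def remainderIntegral (n : ℕ) : ℝ :=
  (√Real.pi)⁻¹ * ∫ s in Ioi (0 : ℝ), s ^ (-1 / 2 : ℝ) * Real.exp (-(n * s)) * poleSum s

theorem abs_exp_neg_natCast_mul_le (n : ℕ) (s : ℝ) (hs : 0 < s) :
    |Real.exp (-(n * s))| ≤ 1 := by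
  rw [abs_of_pos (Real.exp_pos _), Real.exp_le_one_iff]
  have : 0 ≤ (n : ℝ) * s := by positivity
  linarith

theorem hasSum_remainderIntegral (n : ℕ) :
    HasSum (fun m => (√Real.pi)⁻¹ * ∫ s in Ioi (0 : ℝ),
      s ^ (-1 / 2 : ℝ) * Real.exp (-(n * s)) * (1 / (s ^ 2 + freq m ^ 2)))
      (remainderIntegral n) :=
  (hasSum_integral_div_sq_add_freq_sq (by fun_prop) (abs_exp_neg_natCast_mul_le n)).mul_left _

theorem zetaThreeHalves_eq_tsum :
    zetaThreeHalves = ∑' m : ℕ, 1 / ((m + 1 : ℕ) : ℝ) ^ (3 / 2 : ℝ) := by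
  rw [zetaThreeHalves, zeta_eq_tsum_one_div_nat_add_one_cpow (by norm_num)]
  have h : ∀ m : ℕ, 1 / ((m : ℂ) + 1) ^ (3 / 2 : ℂ) =
      ((1 / ((m + 1 : ℕ) : ℝ) ^ (3 / 2 : ℝ) : ℝ) : ℂ) := by
    intro m
    rw [Complex.ofReal_div, Complex.ofReal_cpow (by positivity)]
    push_cast
    rfl
  simp only [h]
  rw [← Complex.ofReal_tsum, Complex.ofReal_re]

/-- Without the exponential, the m-th term is an explicit multiple of (m+1)^(-3/2). -/
theorem remainderIntegral_zero :
    remainderIntegral 0 = 1 / (4 * Real.pi) * zetaThreeHalves := by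
  have hpi := Real.pi_pos
  have hs : 0 < √Real.pi := by positivity
  rw [zetaThreeHalves_eq_tsum, ← tsum_mul_left, ← (hasSum_remainderIntegral 0).tsum_eq]
  refine tsum_congr fun m => ?_
  simp only [Nat.cast_zero, zero_mul, neg_zero, Real.exp_zero, mul_one]
  rw [(integral_rpow_div_sq_add_sq (freq_pos m)).2, ← mul_assoc, ← weight, weight_eq]
  have e : (2 * Real.pi) ^ (-3 / 2 : ℝ) = (2 * Real.pi)⁻¹ * (√2 * √Real.pi)⁻¹ := by
    rw [← Real.sqrt_mul (by norm_num), Real.sqrt_eq_rpow, ← Real.rpow_neg (by positivity),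
      ← Real.rpow_neg_one (2 * Real.pi), ← Real.rpow_add (by positivity)]
    norm_num
  have h2 : √2 ^ 2 = 2 := Real.sq_sqrt (by norm_num)
  have hp2 : √Real.pi ^ 2 = Real.pi := Real.sq_sqrt hpi.le
  rw [e]
  have key : (√Real.pi)⁻¹ * ((2 * Real.pi)⁻¹ * (√2 * √Real.pi)⁻¹) * (Real.pi / √2) =
      1 / (4 * Real.pi) := by
    have : (√Real.pi)⁻¹ * ((2 * Real.pi)⁻¹ * (√2 * √Real.pi)⁻¹) * (Real.pi / √2) =
        Real.pi / (2 * Real.pi * √2 ^ 2 * √Real.pi ^ 2) := by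
      field_simp
    rw [this, h2, hp2]
    field_simp
    norm_num
  rw [← key]
  ring

/-- Rescaling the integration variable by `2π(m+1)/n`. -/
theorem integral_eq_weight_mul_laplaceHalf {n : ℕ} (hn : 1 ≤ n) (m : ℕ) :
    (√Real.pi)⁻¹ * ∫ s in Ioi (0 : ℝ),
      s ^ (-1 / 2 : ℝ) * Real.exp (-(n * s)) * (1 / (s ^ 2 + freq m ^ 2)) =
      √n * (weight m * laplaceHalf (freq m) (fun u => n / ((n : ℝ) ^ 2 + u ^ 2))) := by
  have hn0 : (0 : ℝ) < n := by exact_mod_cast hn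
  have hc := freq_pos m
  set c := freq m with hcdef
  -- With s = (c/n) u, ns becomes cu and s² + c² becomes (c/n)² (u² + n²).
  have hb : 0 < c / n := by positivity
  have h := integral_comp_mul_left_Ioi (fun s : ℝ =>
    s ^ (-1 / 2 : ℝ) * Real.exp (-(n * s)) * (1 / (s ^ 2 + c ^ 2))) 0 hb
  rw [mul_zero, smul_eq_mul] at h
  have h2 : ∫ u in Ioi (0 : ℝ), (c / n * u) ^ (-1 / 2 : ℝ) * Real.exp (-(n * (c / n * u))) *
      (1 / ((c / n * u) ^ 2 + c ^ 2)) =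
      (c / n) ^ (-1 / 2 : ℝ) * (n / c ^ 2) *
        laplaceHalf c (fun u => n / ((n : ℝ) ^ 2 + u ^ 2)) := by
    rw [laplaceHalf, ← integral_const_mul]
    refine setIntegral_congr_fun measurableSet_Ioi fun u (hu : 0 < u) => ?_
    rw [Real.mul_rpow hb.le hu.le, show (n : ℝ) * (c / n * u) = c * u by field_simp]
    field_simp
    ring
  rw [h2] at h
  have e : (c / n) * (c / n) ^ (-1 / 2 : ℝ) * (n / c ^ 2) = √n * c ^ (-3 / 2 : ℝ) := by
    have e1 : c ^ (-3 / 2 : ℝ) = c ^ (-1 / 2 : ℝ) * c⁻¹ := by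
      rw [← Real.rpow_neg_one c, ← Real.rpow_add hc]
      norm_num
    have e2 : (c / n) ^ (-1 / 2 : ℝ) = c ^ (-1 / 2 : ℝ) * √n := by
      rw [Real.div_rpow hc.le hn0.le, Real.sqrt_eq_rpow, div_eq_mul_inv, ← Real.rpow_neg hn0.le]
      norm_num
    rw [e1, e2]
    field_simp
  have h3 : ∫ s in Ioi (0 : ℝ),
      s ^ (-1 / 2 : ℝ) * Real.exp (-(n * s)) * (1 / (s ^ 2 + c ^ 2)) =
      √n * c ^ (-3 / 2 : ℝ) * laplaceHalf c (fun u => n / ((n : ℝ) ^ 2 + u ^ 2)) := by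
    rw [← e, mul_assoc (c / n), mul_assoc (c / n), h, mul_inv_cancel_left₀ hb.ne']
  rw [h3, weight]
  ring

theorem hasSum_weight_mul_laplaceHalf {n : ℕ} (hn : 1 ≤ n) :
    HasSum (fun m => weight m * laplaceHalf (freq m) (fun u => n / ((n : ℝ) ^ 2 + u ^ 2)))
      (remainderIntegral n / √n) := by
  have hn0 : 0 < √(n : ℝ) := Real.sqrt_pos.mpr (by exact_mod_cast hn)
  refine ((hasSum_remainderIntegral n).div_const √n).congr_fun fun m => ?_
  rw [integral_eq_weight_mul_laplaceHalf hn, mul_div_cancel_left₀ _ hn0.ne']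

/-! ### The trapezoidal error and the summation formula -/

theorem integrableOn_natCast_add_rpow (n : ℕ) :
    IntegrableOn (fun t : ℝ => (n + t) ^ (-1 / 2 : ℝ)) (Ioc 0 1) := by
  have h : IntegrableOn (fun t : ℝ => t ^ (-1 / 2 : ℝ)) (Ioc 0 1) :=
    (intervalIntegrable_iff_integrableOn_Ioc_of_le zero_le_one).mp
      (intervalIntegral.intervalIntegrable_rpow' (by norm_num))
  refine Integrable.mono' h (Measurable.aestronglyMeasurable (by fun_prop)) ((ae_restrict_iff' measurableSet_Ioc).mpr
    (.of_forall fun t ht => ?_))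
  have ht0 : 0 < t := ht.1
  have hn : (0 : ℝ) ≤ n := Nat.cast_nonneg n
  rw [Real.norm_of_nonneg (by positivity)]
  exact Real.rpow_le_rpow_of_nonpos ht0 (by linarith) (by norm_num)

theorem integral_rpow_neg_half_mul_exp {x : ℝ} (hx : 0 < x) :
    ∫ s in Ioi (0 : ℝ), s ^ (-1 / 2 : ℝ) * Real.exp (-(x * s)) =
      √Real.pi * x ^ (-1 / 2 : ℝ) := by
  have h := laplaceHalf_pow hx 0
  simp only [laplaceHalf, pow_zero, mul_one, Nat.cast_zero, zero_add, Real.Gamma_one_half_eq] at h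
  rw [h]
  norm_num

/-- Fubini: the inner norm integrals are √π |1/2 - t| (n + t)^(-1/2), integrable on (0, 1] even when
n = 0. -/
theorem integral_swap_half_sub (n : ℕ) :
    ∫ s in Ioi (0 : ℝ), ∫ t in (0 : ℝ)..1,
      (1 / 2 - t) * (s ^ (-1 / 2 : ℝ) * Real.exp (-((n + t) * s))) =
      √Real.pi * ∫ t in (0 : ℝ)..1, (1 / 2 - t) * (n + t) ^ (-1 / 2 : ℝ) := by
  have hn : (0 : ℝ) ≤ n := Nat.cast_nonneg n
  have hnorm : ∀ t ∈ Ioc (0 : ℝ) 1,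
      ∫ s in Ioi (0 : ℝ), ‖(1 / 2 - t) * (s ^ (-1 / 2 : ℝ) * Real.exp (-((n + t) * s)))‖ =
      √Real.pi * (|1 / 2 - t| * (n + t) ^ (-1 / 2 : ℝ)) := by
    intro t ht
    have ht0 : 0 < t := ht.1
    have e : √Real.pi * (|1 / 2 - t| * (n + t) ^ (-1 / 2 : ℝ)) =
        |1 / 2 - t| * (√Real.pi * (n + t) ^ (-1 / 2 : ℝ)) := by ring
    rw [e, ← integral_rpow_neg_half_mul_exp (by linarith : 0 < n + t), ← integral_const_mul]
    refine setIntegral_congr_fun measurableSet_Ioi fun s (hs : 0 < s) => ?_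
    rw [norm_mul, Real.norm_eq_abs, Real.norm_of_nonneg (by positivity)]
  have hint : Integrable (Function.uncurry fun t s : ℝ =>
      (1 / 2 - t) * (s ^ (-1 / 2 : ℝ) * Real.exp (-((n + t) * s))))
      ((volume.restrict (uIoc 0 1)).prod (volume.restrict (Ioi (0 : ℝ)))) := by
    rw [uIoc_of_le zero_le_one, integrable_prod_iff]
    · constructor
      · filter_upwards [ae_restrict_mem measurableSet_Ioc] with t ht
        have ht0 : 0 < t := ht.1
        exact (integrableOn_rpow_mul_exp_neg_mul (a := -1 / 2) (by norm_num)
          (by linarith : 0 < n + t)).const_mul (1 / 2 - t)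
      · have h : IntegrableOn (fun t : ℝ => √Real.pi * (|1 / 2 - t| * (n + t) ^ (-1 / 2 : ℝ)))
            (Ioc 0 1) := by
          refine Integrable.const_mul ?_ _
          refine Integrable.bdd_mul (c := 1) (integrableOn_natCast_add_rpow n) (by fun_prop) ?_
          filter_upwards [ae_restrict_mem measurableSet_Ioc] with t ht
          rw [Real.norm_eq_abs, abs_abs, abs_le]
          constructor <;> linarith [ht.1, ht.2]
        exact IntegrableOn.congr_fun h (fun t ht => (hnorm t ht).symm) measurableSet_Ioc
    · refine Measurable.aestronglyMeasurable ?_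
      unfold Function.uncurry
      fun_prop
  rw [← intervalIntegral_integral_swap hint, ← intervalIntegral.integral_const_mul]
  refine intervalIntegral.integral_congr_ae (.of_forall fun t ht => ?_)
  rw [uIoc_of_le zero_le_one] at ht
  have ht0 : 0 < t := ht.1
  rw [integral_const_mul, integral_rpow_neg_half_mul_exp (by linarith : 0 < n + t)]
  ring

theorem integral_half_sub_mul_rpow (n : ℕ) :
    ∫ t in (0 : ℝ)..1, 1 / 2 * ((1 / 2 - t) * (n + t) ^ (-1 / 2 : ℝ)) =
      2 / 3 * ((n + 1) * √((n : ℝ) + 1) - n * √n) - 1 / 2 * (√((n : ℝ) + 1) + √n) := by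
  have hn : (0 : ℝ) ≤ n := Nat.cast_nonneg n
  -- The primitive comes from integration by parts. It is continuous on [0, 1] but differentiated
  -- only inside, since for n = 0 the integrand is singular at t = 0.
  have hcont : Continuous fun t : ℝ => (1 / 2 - t) * √(n + t) + 2 / 3 * ((n + t) * √(n + t)) := by
    fun_prop
  rw [intervalIntegral.integral_eq_sub_of_hasDerivAt_of_le zero_le_one hcont.continuousOn
    (f' := fun t => 1 / 2 * ((1 / 2 - t) * (n + t) ^ (-1 / 2 : ℝ)))]
  · simp only [add_zero, sub_zero]
    ring
  · intro t ht
    have hx : 0 < (n : ℝ) + t := by linarith [ht.1]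
    have hsq : 0 < √((n : ℝ) + t) := Real.sqrt_pos.mpr hx
    have d0 : HasDerivAt (fun t : ℝ => (n : ℝ) + t) 1 t := (hasDerivAt_id t).const_add _
    have d1 : HasDerivAt (fun t : ℝ => √((n : ℝ) + t)) (1 / (2 * √((n : ℝ) + t))) t :=
      d0.sqrt hx.ne'
    have d2 : HasDerivAt (fun t : ℝ => 1 / 2 - t) (-1) t := (hasDerivAt_id t).const_sub _
    refine ((d2.mul d1).add ((d0.mul d1).const_mul (2 / 3))).congr_deriv ?_
    have e : ((n : ℝ) + t) ^ (-1 / 2 : ℝ) = (√((n : ℝ) + t))⁻¹ := by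
      rw [Real.sqrt_eq_rpow, ← Real.rpow_neg hx.le]
      norm_num
    have hs2 : √((n : ℝ) + t) ^ 2 = n + t := Real.sq_sqrt hx.le
    rw [e]
    generalize √((n : ℝ) + t) = r at *
    rw [← hs2]
    field_simp
    ring
  · refine IntervalIntegrable.const_mul ?_ _
    refine IntervalIntegrable.continuousOn_mul ?_ (by fun_prop)
    exact (intervalIntegrable_iff_integrableOn_Ioc_of_le zero_le_one).mpr
      (integrableOn_natCast_add_rpow n)

/-- The right side is the integral of √x over [n, n+1] minus its trapezoidal approximation. -/
theorem remainderIntegral_sub_succ (n : ℕ) :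
    remainderIntegral n - remainderIntegral (n + 1) =
      2 / 3 * ((n + 1) * √((n : ℝ) + 1) - n * √n) - 1 / 2 * (√((n : ℝ) + 1) + √n) := by
  have hpi : √Real.pi ≠ 0 := by have := Real.pi_pos; positivity
  have hw1 : ∀ s : ℝ, 0 < s → |Real.exp (-(n * s)) * (1 - Real.exp (-s))| ≤ 1 := by
    intro s hs
    rw [abs_mul]
    refine mul_le_one₀ (abs_exp_neg_natCast_mul_le n s hs) (abs_nonneg _) ?_
    have h1 : Real.exp (-s) < 1 := by simpa using hs
    rw [abs_le]
    constructor <;> linarith [Real.exp_pos (-s)]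
  have h1 := (hasSum_integral_div_sq_add_freq_sq (by fun_prop) hw1).mul_left (√Real.pi)⁻¹
  have h2 := (hasSum_remainderIntegral n).sub (hasSum_remainderIntegral (n + 1))
  have h3 : ∀ m, (√Real.pi)⁻¹ * (∫ s in Ioi (0 : ℝ),
      s ^ (-1 / 2 : ℝ) * Real.exp (-(n * s)) * (1 / (s ^ 2 + freq m ^ 2))) -
      (√Real.pi)⁻¹ * (∫ s in Ioi (0 : ℝ),
      s ^ (-1 / 2 : ℝ) * Real.exp (-(((n + 1 : ℕ) : ℝ) * s)) * (1 / (s ^ 2 + freq m ^ 2))) =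
      (√Real.pi)⁻¹ * ∫ s in Ioi (0 : ℝ), s ^ (-1 / 2 : ℝ) *
        (Real.exp (-(n * s)) * (1 - Real.exp (-s))) * (1 / (s ^ 2 + freq m ^ 2)) := by
    intro m
    rw [← mul_sub, ← integral_sub
      (integrableOn_rpow_mul_div_sq_add_sq (freq_pos m) (by fun_prop)
        (abs_exp_neg_natCast_mul_le n)).1
      (integrableOn_rpow_mul_div_sq_add_sq (freq_pos m) (by fun_prop)
        (abs_exp_neg_natCast_mul_le (n + 1))).1]
    congr 1
    refine integral_congr_ae (.of_forall fun s => ?_)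
    have e : Real.exp (-(((n + 1 : ℕ) : ℝ) * s)) = Real.exp (-(n * s)) * Real.exp (-s) := by
      rw [← Real.exp_add]
      push_cast
      ring_nf
    simp only
    rw [e]
    ring
  simp only [h3] at h2
  rw [h2.unique h1, ← integral_half_sub_mul_rpow, intervalIntegral.integral_const_mul]
  have h4 : ∫ s in Ioi (0 : ℝ), s ^ (-1 / 2 : ℝ) *
      (Real.exp (-(n * s)) * (1 - Real.exp (-s))) * poleSum s =
      1 / 2 * ∫ s in Ioi (0 : ℝ), ∫ t in (0 : ℝ)..1,
        (1 / 2 - t) * (s ^ (-1 / 2 : ℝ) * Real.exp (-((n + t) * s))) := by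
    rw [← integral_const_mul]
    refine setIntegral_congr_fun measurableSet_Ioi fun s (hs : 0 < s) => ?_
    have e : ∀ t : ℝ, (1 / 2 - t) * (s ^ (-1 / 2 : ℝ) * Real.exp (-((n + t) * s))) =
        s ^ (-1 / 2 : ℝ) * Real.exp (-(n * s)) * ((1 / 2 - t) * Real.exp (-(t * s))) := by
      intro t
      rw [show -(((n : ℝ) + t) * s) = -(n * s) + -(t * s) by ring, Real.exp_add]
      ring
    simp only [e]
    rw [intervalIntegral.integral_const_mul]
    linear_combination s ^ (-1 / 2 : ℝ) * Real.exp (-(n * s)) * one_sub_exp_mul_poleSum hs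
  rw [h4, integral_swap_half_sub]
  field_simp

theorem sum_sqrt_eq_remainderIntegral (n : ℕ) :
    ∑ k ∈ Finset.range (n + 1), √(k : ℝ) =
      2 / 3 * (n * √n) + 1 / 2 * √n - 1 / (4 * Real.pi) * zetaThreeHalves +
        remainderIntegral n := by
  induction n with
  | zero => simp [remainderIntegral_zero]
  | succ n ih =>
    rw [Finset.sum_range_succ, ih]
    push_cast
    linear_combination remainderIntegral_sub_succ n

theorem natCast_rpow_three_halves (n : ℕ) : (n : ℝ) ^ (3 / 2 : ℝ) = n * √n := by
  rw [Real.sqrt_eq_rpow, ← Real.rpow_one_add' (Nat.cast_nonneg n) (by norm_num)]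
  norm_num


end SqrtSum

/-! ### The three expansions -/

open SqrtSum

/-- The infinite sums over `k ≥ 1` are written as sums over `k : ℕ` of the term with index `k + 1`. -/
theorem mainTheorem5 :
    (∀ n : ℕ, 1 ≤ n →
      (Summable (fun k : ℕ => (SqrtSum.coeffA (k + 1) : ℝ) / SqrtSum.risingProd n (k + 1)) ∧
        ∑ k ∈ Finset.range (n + 1), Real.sqrt (k : ℝ) =
          2 / 3 * (n : ℝ) ^ (3 / 2 : ℝ) + 1 / 2 * Real.sqrt n
            - 1 / (4 * Real.pi) * SqrtSum.zetaThreeHalves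
            + Real.sqrt n *
              ∑' k : ℕ, (SqrtSum.coeffA (k + 1) : ℝ) / SqrtSum.risingProd n (k + 1)) ∧
      (Summable (fun k : ℕ =>
          (SqrtSum.coeffB (k + 1) : ℝ) / (Real.sqrt n * SqrtSum.risingProd n (k + 1))) ∧
        ∑ k ∈ Finset.range (n + 1), Real.sqrt (k : ℝ) =
          2 / 3 * (n : ℝ) ^ (3 / 2 : ℝ) + 1 / 2 * Real.sqrt n
            - 1 / (4 * Real.pi) * SqrtSum.zetaThreeHalves
            + 1 / (24 * Real.sqrt n)
            + ∑' k : ℕ,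
              (SqrtSum.coeffB (k + 1) : ℝ) / (Real.sqrt n * SqrtSum.risingProd n (k + 1))) ∧
      (Summable (fun k : ℕ => (SqrtSum.coeffC (k + 1) : ℝ) / SqrtSum.risingProd n (k + 1)) ∧
        ∑ k ∈ Finset.range (n + 1), Real.sqrt (k : ℝ) =
          2 / 3 * (n : ℝ) ^ (3 / 2 : ℝ)
            - 1 / (4 * Real.pi) * SqrtSum.zetaThreeHalves
            + (n : ℝ) * Real.sqrt n *
              ∑' k : ℕ, (SqrtSum.coeffC (k + 1) : ℝ) / SqrtSum.risingProd n (k + 1))) ∧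
    (SqrtSum.coeffA 1 = 1 / 24 ∧ SqrtSum.coeffA 2 = 1 / 24 ∧
      SqrtSum.coeffA 3 = 53 / 640 ∧ SqrtSum.coeffA 4 = 79 / 320) ∧
    (SqrtSum.coeffB 1 = 0 ∧ SqrtSum.coeffB 2 = -1 / 1920 ∧ SqrtSum.coeffB 3 = -1 / 640 ∧
      SqrtSum.coeffB 4 = -259 / 46080 ∧ SqrtSum.coeffB 5 = -115 / 4608) ∧
    (SqrtSum.coeffC 1 = 1 / 2 ∧ SqrtSum.coeffC 2 = 13 / 24 ∧
      SqrtSum.coeffC 3 = 9 / 8 ∧ SqrtSum.coeffC 4 = 2213 / 640) := by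
  refine ⟨fun n hn => ?_, coeff_values⟩
  have hn0 : (0 : ℝ) < n := by exact_mod_cast hn
  have hs0 : 0 < √(n : ℝ) := Real.sqrt_pos.mpr hn0
  have hsq : √(n : ℝ) ^ 2 = n := Real.sq_sqrt hn0.le
  have hA := hasSum_coeffA_div_risingProd hn (hasSum_weight_mul_laplaceHalf hn)
  obtain ⟨M, hMA, hMB⟩ := exists_abs_coeff_le
  have sA := summable_and_tendsto_of_abs_le hn (le_mul_factorial_sqrt hMA)
  have sB := summable_and_tendsto_of_abs_le hn (le_mul_factorial_sqrt hMB)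
  have sC := summable_and_tendsto_of_abs_le hn 
    (abs_le_of_recursion (c := fun k => (coeffC (k + 1) : ℝ)) hMA coeffC_add_two)
  -- With A, B, C the three series, `tB` becomes B = nA - 1/24 and `tC` becomes A = nC - 1/2. The
  -- constants a_1 and c_1 account for the extra term 1/(24√n) and the missing term √n/2.
  have tB := tsum_div_risingProd_eq (c := fun k => (coeffA (k + 1) : ℝ)) coeffA_add_two sA.1 sA.2 sB.1
  have tC := tsum_div_risingProd_eq (c := fun k => (coeffC (k + 1) : ℝ)) coeffC_add_two sC.1 sC.2 sA.1
  have a1 : (coeffA (0 + 1) : ℝ) = 1 / 24 := by rw [coeff_values.1.1]; norm_num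
  have c1 : (coeffC (0 + 1) : ℝ) = 1 / 2 := by rw [coeff_values.2.2.1]; norm_num
  rw [hA.tsum_eq, a1] at tB
  rw [hA.tsum_eq, c1] at tC
  have hB : (fun k : ℕ => (coeffB (k + 1) : ℝ) / (√n * risingProd n (k + 1))) =
      fun k => (√(n : ℝ))⁻¹ * ((coeffB (k + 1) : ℝ) / risingProd n (k + 1)) := by
    funext k
    rw [mul_comm (√(n : ℝ)), ← div_div, div_eq_inv_mul]
  rw [natCast_rpow_three_halves, sum_sqrt_eq_remainderIntegral]
  refine ⟨⟨sA.1, ?_⟩, ⟨?_, ?_⟩, sC.1, ?_⟩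
  · rw [hA.tsum_eq]
    field_simp
  · rw [hB]
    exact sB.1.mul_left _
  · rw [hB, tsum_mul_left, tB]
    generalize √(n : ℝ) = r at *
    rw [← hsq]
    field_simp
    ring
  · rw [div_eq_iff hs0.ne'] at tC
    linear_combination tC
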